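/- **Setting.** Fix $C\ge 1$. Let $A\in\mathbb R^{n\times m}$ have columns $A_1,\dots,A_m$ of unit Euclidean length. $A$ is $(k,\delta)$-RIP if $(1-\delta)\|x\|_2\le\|Ax\|_2\le(1+\delta)\|x\|_2$ for every $x\in\mathbb R^m$ with at most $k$ non-zero coordinates. Let $\mathcal D$ be a symmetric probability distribution supported in $[-C,-1]\cup[1,C]$. Samples $y^{(1)},\dots,y^{(N)}$ have the form $y^{(r)}=Ax^{(r)}$, where the supports $S_1,\dots,S_N\subseteq[m]$ of the $x^{(r)}$ are arbitrary given sets of size at most $k$ and all non-zero entries $x^{(r)}_i$ ($i\in S_r$, $r\in[N]$) are independent with distribution $\mathcal D$. **TestColumn**$(z,\{y^{(r)}\},\kappa,\kappa',\eta)$: Let $\widetilde\kappa_1$ be the fraction of samples with $|\langle z,y^{(r)}\rangle|\in[1-\eta,C(1+\eta)]$ and $\widetilde\kappa_0$ the fraction with $|\langle z,y^{(r)}\rangle|\notin[1-\eta,C(1+\eta)]\cup[0,C\eta]$. If $\widetilde\kappa_0<\kappa$ and $\widetilde\kappa_1\ge\kappa'$, return $(\mathrm{YES},\widehat z)$, where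 $z'$ is the mean of the samples with $\langle y^{(r)},z\rangle\ge\frac12$ and $\widehat z=z'/\|z'\|_2$; otherwise return $(\mathrm{NO},\emptyset)$. (By convention a mean over an empty set and $0/\|0\|_2$ are $0$.) **Theorem.** For every $C\ge1$ there are constants $c_0,\dots,c_5>0$, depending only on $C$, such that the following holds for all integers $n,m,k,N$ with $k\ge2$ and all reals $\gamma\in(0,\frac12]$, $\gamma_0\in(0,1)$, $q_{\min}>0$, $0<\eta_0<\eta<1$ with $$\sqrt{\frac{c_3k}{m}}<\eta<\frac{c_1}{\log^2\left(\frac{mn}{q_{\min}\eta_0}\right)} .$$ Put $\kappa_0:=c_4\gamma_0\eta q_{\min}/(km)$ and suppose that * $N\ge\dfrac{c_2\,knm\log(1/\gamma)}{\eta_0^3\gamma_0\kappa_0}$; * $\mathcal D([1,1+\eta])\ge\gamma_0$; * $A$ is $(k,\delta)$-RIP for some $\delta<\left(\dfrac{\eta}{16C\log(1/\kappa_0)}\right)^2$; * for all $i\in[m]$ and $T\subseteq[m]\setminus\{i\}$ with $|T|\le c_3/\eta^2$, at least $q_{\min}N$ of the samples have a support that contains $i$ and is disjoint from $T$. Let $z\in\mathbb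 R^n$ be a fixed unit vector and run TestColumn$(z,\{y^{(r)}\},2\kappa_0,\ c_5q_{\min}\gamma_0\eta,\ \eta)$. Then: * *(Running time)* TestColumn takes $O(N)$ time: it is computed, on every input $y^{(1)},\dots,y^{(N)}\in\mathbb R^n$, by an explicit one-pass program which, if each arithmetic operation, absolute value or comparison of reals costs $1$ step and each operation on vectors of $\mathbb R^n$ (inner product, sum, division by a scalar, norm) costs $w\ge1$ steps, takes at most $c_0wN$ steps. (So it uses $O(N)$ vector and scalar operations.) * With probability at least $1-\gamma$ over the values $x^{(r)}_i$, both of the following hold. * *(Completeness)* If $\|z-bA_i\|_2\le\dfrac{\eta}{8C\log(1/\kappa_0)}$ for some $i\in[m]$, $b\in\{-1,1\}$, then TestColumn returns $(\mathrm{YES},\widehat z)$ for some $\widehat z$. * *(Soundness)* If TestColumn returns $(\mathrm{YES},\widehat z)$, then there are $i\in[m]$, $b\in\{-1,1\}$ with $\|z-bA_i\|_2\le\sqrt{8\eta}$ and $\|\widehat z-bA_i\|_2\le\eta_0$. -/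

import Mathlib

open MeasureTheory ProbabilityTheory
open scoped InnerProductSpace Matrix

noncomputable section

namespace DictTest

/-- `ℝⁿ` with the Euclidean norm. -/
abbrev Vec (n : ℕ) : Type := EuclideanSpace ℝ (Fin n)

/-- The `i`-th column of an `n × m` matrix, as a Euclidean vector. -/
def column {n m : ℕ} (A : Matrix (Fin n) (Fin m) ℝ) (i : Fin m) : Vec n :=
  WithLp.toLp 2 (fun a => A a i)

/-- The product `A x`, as a Euclidean vector. -/
def apply {n m : ℕ} (A : Matrix (Fin n) (Fin m) ℝ) (x : Fin m → ℝ) : Vec n :=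
  WithLp.toLp 2 (A *ᵥ x)

/-- The restricted isometry property `(k, δ)`-RIP: `(1 - δ) ‖x‖ ≤ ‖A x‖ ≤ (1 + δ) ‖x‖` for every
vector `x` with at most `k` non-zero coordinates. -/
def IsRIP {n m : ℕ} (k : ℕ) (δ : ℝ) (A : Matrix (Fin n) (Fin m) ℝ) : Prop :=
  ∀ x : Fin m → ℝ, {i | x i ≠ 0}.ncard ≤ k →
    (1 - δ) * ‖(WithLp.toLp 2 x : Vec m)‖ ≤ ‖apply A x‖ ∧
      ‖apply A x‖ ≤ (1 + δ) * ‖(WithLp.toLp 2 x : Vec m)‖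

/-- Spike-and-slab value distributions: symmetric probability measures supported in
`[-C, -1] ∪ [1, C]`. (Such a measure automatically has mean zero.) -/
structure IsSpikeSlab (C : ℝ) (D : Measure ℝ) : Prop where
  prob : IsProbabilityMeasure D
  symm : D.map (fun t => -t) = D
  supp : ∀ᵐ t ∂D, t ∈ Set.Icc (-C) (-1) ∪ Set.Icc 1 C

/-- `x` is a family of `N` random coefficient vectors in `ℝᵐ` with given supports `S r`: the
coordinates outside the support vanish, and the coordinates inside the supports are, over all
vectors together, independent with common distribution `D`. -/
structure IsCoeffSample {N m : ℕ} {Ω : Type*} [MeasurableSpace Ω] (P : Measure Ω) (D : Measure ℝ)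
    (S : Fin N → Finset (Fin m)) (x : Fin N → Fin m → Ω → ℝ) : Prop where
  measurable : ∀ r i, Measurable (x r i)
  zero : ∀ r i, i ∉ S r → ∀ ω, x r i ω = 0
  law : ∀ r i, i ∈ S r → P.map (x r i) = D
  indep : iIndepFun
    (fun p : {p : Fin N × Fin m // p.2 ∈ S p.1} => x p.1.1 p.1.2) P

/-! ### The algorithm TestColumn -/

open Classical in
/-- The samples averaged in the output of TestColumn: those with `⟨y r, z⟩ ≥ 1/2`. -/
def selected {n N : ℕ} (z : Vec n) (y : Fin N → Vec n) : Finset (Fin N) :=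
  Finset.univ.filter (fun r => 1 / 2 ≤ ⟪y r, z⟫_ℝ)

/-- The mean `z'` of the selected samples. -/
def selectedMean {n N : ℕ} (z : Vec n) (y : Fin N → Vec n) : Vec n :=
  (((selected z y).card : ℝ))⁻¹ • ∑ r ∈ selected z y, y r

open Classical in
/-- The fraction of samples with `|⟨z, y r⟩| ∈ [1 - η, C (1 + η)]`. -/
def fracHigh {n N : ℕ} (C : ℝ) (z : Vec n) (y : Fin N → Vec n) (η : ℝ) : ℝ :=
  ((Finset.univ.filter
    (fun r => |⟪z, y r⟫_ℝ| ∈ Set.Icc (1 - η) (C * (1 + η)))).card : ℝ) / N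

open Classical in
/-- The fraction of samples with `|⟨z, y r⟩| ∉ [1 - η, C (1 + η)] ∪ [0, C η]`. -/
def fracBad {n N : ℕ} (C : ℝ) (z : Vec n) (y : Fin N → Vec n) (η : ℝ) : ℝ :=
  ((Finset.univ.filter
    (fun r => |⟪z, y r⟫_ℝ| ∉ Set.Icc (1 - η) (C * (1 + η)) ∪ Set.Icc 0 (C * η))).card : ℝ) / N

open Classical in
/-- TestColumn. The value `some v` stands for `(YES, v)`, the value `none` for `(NO, ∅)`. -/
def testColumn {n N : ℕ} (C : ℝ) (z : Vec n) (y : Fin N → Vec n) (κ₀ κ₁ η : ℝ) :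
    Option (Vec n) :=
  if fracBad C z y η < κ₀ ∧ κ₁ ≤ fracHigh C z y η then
    some (‖selectedMean z y‖⁻¹ • selectedMean z y)
  else none

/-! ### TestColumn as a program with a step count

The program below uses only the listed primitives. A primitive on real numbers costs one step;
a primitive on vectors of `ℝⁿ` (inner product, sum, division by a scalar, norm) costs `w` steps,
where `w` is a parameter: `w = 1` counts vector operations, and `w = 2 n` bounds the number of
elementary operations on real numbers. -/

/-- A computed value together with the number of steps spent. -/
structure Timed (α : Type) where
  value : α
  steps : ℕ

instance : Monad Timed where
  pure a := ⟨a, 0⟩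
  bind p f := ⟨(f p.value).value, p.steps + (f p.value).steps⟩

namespace Timed

def add (a b : ℝ) : Timed ℝ := ⟨a + b, 1⟩
def sub (a b : ℝ) : Timed ℝ := ⟨a - b, 1⟩
def mul (a b : ℝ) : Timed ℝ := ⟨a * b, 1⟩
def div (a b : ℝ) : Timed ℝ := ⟨a / b, 1⟩
def abs (a : ℝ) : Timed ℝ := ⟨|a|, 1⟩
open Classical in
def le (a b : ℝ) : Timed Bool := ⟨decide (a ≤ b), 1⟩
open Classical in
def lt (a b : ℝ) : Timed Bool := ⟨decide (a < b), 1⟩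
def vinner {n : ℕ} (w : ℕ) (u v : Vec n) : Timed ℝ := ⟨⟪u, v⟫_ℝ, w⟩
def vadd {n : ℕ} (w : ℕ) (u v : Vec n) : Timed (Vec n) := ⟨u + v, w⟩
def vdiv {n : ℕ} (w : ℕ) (u : Vec n) (a : ℝ) : Timed (Vec n) := ⟨a⁻¹ • u, w⟩
def vnorm {n : ℕ} (w : ℕ) (u : Vec n) : Timed ℝ := ⟨‖u‖, w⟩

end Timed

/-- The running totals of the single pass over the samples. -/
structure Tally (n : ℕ) where
  high : ℝ
  bad : ℝ
  num : ℝ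
  sum : Vec n

/-- The treatment of one sample `v`. The arguments `lo`, `hi`, `sm` are the interval end points
`1 - η`, `C (1 + η)`, `C η`. -/
def tallyStep {n : ℕ} (w : ℕ) (z : Vec n) (lo hi sm : ℝ) (s : Tally n) (v : Vec n) :
    Timed (Tally n) := do
  let p ← Timed.vinner w z v
  let a ← Timed.abs p
  let b₁ ← Timed.le lo a
  let b₂ ← Timed.le a hi
  let b₃ ← Timed.le a sm
  let high ← if b₁ && b₂ then Timed.add s.high 1 else pure s.high
  let bad ← if !(b₁ && b₂) && !b₃ then Timed.add s.bad 1 else pure s.bad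
  let b₄ ← Timed.le (1 / 2) p
  let num ← if b₄ then Timed.add s.num 1 else pure s.num
  let sum ← if b₄ then Timed.vadd w s.sum v else pure s.sum
  pure ⟨high, bad, num, sum⟩

/-- TestColumn as a program with a step count. -/
def testColumnProgram {n N : ℕ} (w : ℕ) (C : ℝ) (z : Vec n) (y : Fin N → Vec n)
    (κ₀ κ₁ η : ℝ) : Timed (Option (Vec n)) := do
  let lo ← Timed.sub 1 η
  let t ← Timed.add 1 η
  let hi ← Timed.mul C t
  let sm ← Timed.mul C η
  let s ← (List.finRange N).foldlM (fun s r => tallyStep w z lo hi sm s (y r)) ⟨0, 0, 0, 0⟩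
  let f₁ ← Timed.div s.high (N : ℝ)
  let f₀ ← Timed.div s.bad (N : ℝ)
  let b₀ ← Timed.lt f₀ κ₀
  let b₁ ← Timed.le κ₁ f₁
  if b₀ && b₁ then do
    let z' ← Timed.vdiv w s.sum s.num
    let l ← Timed.vnorm w z'
    let out ← Timed.vdiv w z' l
    pure (some out)
  else pure none

end DictTest

end

/-!
TestColumn is analysed through the correlations `a j = ⟨z, A j⟩` of the tested direction with the
columns: a sample `y = A x` with support `S` has `⟨z, y⟩ = ∑ j ∈ S, a j * x j`, a sum of independent
symmetric variables.

*Geometry.* The restricted isometry property makes the columns nearly orthogonal. So `z` has a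
correlation of size at least `η / (2 C)` with at most `8 C² / η²` columns
(`IsRIP.card_le_of_le_abs_inner`), and if `z` is close to `± A i`, then over every small support the
correlations with the other columns have a small sum of squares (`IsRIP.sum_inner_sq_le_of_near`).

*Completeness.* If `z` is very close to `± A i`, Hoeffding's inequality bounds the cross term
`∑ j ∈ S \ {i}, a j * x j` by `η / 2` except with probability `κ₀`. The remaining samples are high
if `i ∈ S` and low otherwise; a Chernoff bound for the number of exceptions concludes.

*Soundness, `z` far from all columns.* Here all `|a j| < 1 - 4 η`. The tool is to change the signs
of the coefficients one after the other: each of the `m + 1` configurations has the law of the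
original sample, and the sum turns into its negative in small steps, so it visits every intermediate
value (`exists_partialFlip_near`, `IsSymmFamily.measureReal_le_of_partialFlip`).
Suppose that bad samples are rare. If some `|a i|` is at least `1 / (3 C)`, consider the samples
whose support contains `i` but none of the other columns with large correlation. With probability at
least `γ₀ / (m + 1)` their cross term is tiny while `x i ∈ [1, 1 + η]`, which makes the sample bad,
a contradiction (`le_measureReal_badSet`). So all `|a j|` are below `1 / (3 C)`. Then a high sample
cannot jump over the forbidden gap on its way to its negative, so high samples are at most `m + 1`
times as frequent as bad ones (`measureReal_highSet_le`), and TestColumn answers NO.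

*Soundness, `z` close to `b A i`.* Now the cross terms have variance of order `η`, and the bound
`η < c₁ / log²` makes the event that one exceeds `1 / 4` polynomially unlikely. Away from these rare
samples exactly those with `b * x i > 0` are selected, so the sum of the selected samples is a large
multiple of `b A i` plus the cross terms, which have mean zero by symmetry and concentrate
coordinatewise (`norm_normalized_mean_sub_le`, `measureReal_mean_near`).
-/

namespace DictTest

/-! ### Independence and Chernoff bounds -/

section Independence

variable {Ω : Type*} [MeasurableSpace Ω] {P : Measure Ω}

/-- Adding identically zero variables to an independent family keeps it independent. -/
lemma iIndepFun_of_subtype {ι : Type*} {f : ι → Ω → ℝ} {p : ι → Prop}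
    [IsProbabilityMeasure P]
    (h0 : ∀ i, ¬ p i → ∀ ω, f i ω = 0) (h : iIndepFun (fun i : {i // p i} => f i) P) :
    iIndepFun f P := by
  classical
  rw [iIndepFun_iff_measure_inter_preimage_eq_mul] at h ⊢
  intro T sets hs
  have hpre : ∀ i, ¬ p i → f i ⁻¹' sets i = if (0 : ℝ) ∈ sets i then Set.univ else ∅ := by
    intro i hi
    ext ω
    by_cases h1 : (0 : ℝ) ∈ sets i <;> simp [h0 i hi ω, h1]
  by_cases hex : ∃ i ∈ T, ¬ p i ∧ (0 : ℝ) ∉ sets i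
  · obtain ⟨i, hiT, hip, h0i⟩ := hex
    have he : f i ⁻¹' sets i = ∅ := by simp [hpre i hip, h0i]
    rw [Finset.prod_eq_zero hiT (by simp [he])]
    refine measure_mono_null (Set.biInter_subset_of_mem hiT) (by simp [he])
  · push Not at hex
    have hu : ∀ i ∈ T, ¬ p i → f i ⁻¹' sets i = Set.univ := fun i hiT hip => by
      simp [hpre i hip, hex i hiT hip]
    have h1 := h (T.subtype p) (sets := fun i => sets i)
      (fun i hi => hs i (by simpa using hi))
    have h2 : (⋂ i ∈ T, f i ⁻¹' sets i) = ⋂ i ∈ T.subtype p, f i ⁻¹' sets i := by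
      ext ω
      simp only [Set.mem_iInter, Finset.mem_subtype, Set.mem_preimage, Subtype.forall]
      refine ⟨fun H a _ ha => H a ha, fun H a ha => ?_⟩
      by_cases hp : p a
      · exact H a hp ha
      · have := hu a ha hp
        exact (this ▸ Set.mem_univ ω : ω ∈ f a ⁻¹' sets a)
    have h3 : ∏ i ∈ T, P (f i ⁻¹' sets i) = ∏ i ∈ T.subtype p, P (f i ⁻¹' sets i) := by
      rw [Finset.prod_subtype_eq_prod_filter (f := fun i => P (f i ⁻¹' sets i)),
        Finset.prod_filter]
      refine Finset.prod_congr rfl fun i hi => ?_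
      by_cases hp : p i
      · simp [hp]
      · simp [hp, hu i hi hp]
    rw [h2, h3, h1]

/-- The rows of an array of independent variables are independent. -/
lemma iIndepFun_curry {ι κ : Type*} [Countable ι] [Countable κ] {X : ι → κ → Ω → ℝ}
    (mX : ∀ i j, Measurable (X i j))
    (h : iIndepFun (fun (p : ι × κ) ω => X p.1 p.2 ω) P) :
    iIndepFun (fun i ω => (X i · ω)) P := by
  have := h.isProbabilityMeasure
  have : ∀ i j, IsProbabilityMeasure (P.map (X i j)) :=
    fun i j => Measure.isProbabilityMeasure_map (mX i j).aemeasurable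
  have hi : ∀ i, iIndepFun (X i) P := fun i =>
    h.precomp (g := fun j => (i, j)) (fun a b hab => by simpa using hab)
  have hcomp : (MeasurableEquiv.curry ι κ ℝ) ∘ (fun ω (p : ι × κ) => X p.1 p.2 ω) =
      fun ω i j => X i j ω := by
    ext; simp [MeasurableEquiv.curry, Function.curry]
  rw [iIndepFun_iff_map_fun_eq_infinitePi_map (by fun_prop), ← hcomp,
    ← Measure.map_map (by fun_prop) (by fun_prop),
    (iIndepFun_iff_map_fun_eq_infinitePi_map (by fun_prop)).1 h,
    Measure.infinitePi_map_curry (fun i j => P.map (X i j))]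
  congr 1
  ext1 i
  rw [← (iIndepFun_iff_map_fun_eq_infinitePi_map (by fun_prop)).1 (hi i)]

/-- Fixed sign changes preserve the joint law of independent symmetric variables. -/
lemma map_signs_eq {κ : Type*} [Fintype κ] [IsProbabilityMeasure P] {X : κ → Ω → ℝ}
    (mX : ∀ j, Measurable (X j))
    (hX : iIndepFun X P) (hsymm : ∀ j, P.map (fun ω => -X j ω) = P.map (X j))
    {s : κ → ℝ} (hs : ∀ j, s j = 1 ∨ s j = -1) :
    P.map (fun ω j => s j * X j ω) = P.map (fun ω j => X j ω) := by
  have h2 : iIndepFun (fun j ω => s j * X j ω) P :=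
    hX.comp (fun j t => s j * t) (fun j => measurable_const_mul _)
  rw [(iIndepFun_iff_map_fun_eq_pi_map (fun j => ((mX j).const_mul _).aemeasurable)).1 h2,
    (iIndepFun_iff_map_fun_eq_pi_map (fun j => (mX j).aemeasurable)).1 hX]
  congr 1
  ext1 j
  rcases hs j with h | h
  · simp [h]
  · simpa [h] using hsymm j

/-- The number of independent events that occur has the moment generating function of a Poisson
variable with the same mean as an upper bound. -/
lemma mgf_count_le {ι : Type*} [Fintype ι] [IsProbabilityMeasure P] {β : ι → Type*}
    [∀ i, MeasurableSpace (β i)] {Y : ∀ i, Ω → β i} (mY : ∀ i, Measurable (Y i))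
    (hY : iIndepFun Y P) {B : ∀ i, Set (β i)} (hB : ∀ i, MeasurableSet (B i)) (t : ℝ) :
    mgf (∑ i, fun ω => (B i).indicator (fun _ => (1 : ℝ)) (Y i ω)) P t ≤
      Real.exp ((Real.exp t - 1) * ∑ i, P.real (Y i ⁻¹' B i)) := by
  have hmeas : ∀ i, Measurable ((B i).indicator (fun _ => (1 : ℝ))) := fun i =>
    measurable_const.indicator (hB i)
  have hind : iIndepFun (fun i ω => (B i).indicator (fun _ => (1 : ℝ)) (Y i ω)) P :=
    hY.comp _ hmeas
  rw [hind.mgf_sum (fun i => (hmeas i).comp (mY i)), Finset.mul_sum, Real.exp_sum]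
  refine Finset.prod_le_prod (fun i _ => mgf_nonneg) fun i _ => ?_
  have h1 : mgf (fun ω => (B i).indicator (fun _ => (1 : ℝ)) (Y i ω)) P t =
      1 + (Real.exp t - 1) * P.real (Y i ⁻¹' B i) := by
    have h2 : (fun ω => Real.exp (t * (B i).indicator (fun _ => (1 : ℝ)) (Y i ω))) =
        fun ω => 1 + (Y i ⁻¹' B i).indicator (fun _ => Real.exp t - 1) ω := by
      ext ω
      by_cases h : Y i ω ∈ B i <;> simp [h]
    rw [mgf, h2, integral_add (integrable_const _)
      ((integrable_const _).indicator (mY i (hB i))), integral_indicator_const _ (mY i (hB i))]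
    simp [mul_comm]
  rw [h1]
  linarith [Real.add_one_le_exp ((Real.exp t - 1) * P.real (Y i ⁻¹' B i))]

open Classical in
/-- Chernoff bound: twice the expected number of events is rarely reached. -/
lemma count_ge_le {ι : Type*} [Fintype ι] [IsProbabilityMeasure P] {β : ι → Type*}
    [∀ i, MeasurableSpace (β i)] {Y : ∀ i, Ω → β i} (mY : ∀ i, Measurable (Y i))
    (hY : iIndepFun Y P) {B : ∀ i, Set (β i)} (hB : ∀ i, MeasurableSet (B i)) {T : ℝ}
    (hT : ∑ i, P.real (Y i ⁻¹' B i) ≤ T / 2) :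
    P.real {ω | T ≤ ((Finset.univ.filter (fun i => Y i ω ∈ B i)).card : ℝ)} ≤
      Real.exp (-T / 8) := by
  have hmeas : ∀ i, Measurable (fun ω => (B i).indicator (fun _ => (1 : ℝ)) (Y i ω)) := fun i =>
    (measurable_const.indicator (hB i)).comp (mY i)
  have hsum : Measurable (∑ i, fun ω => (B i).indicator (fun _ => (1 : ℝ)) (Y i ω)) := by
    convert Finset.univ.measurable_sum fun i _ => hmeas i using 1
    ext ω
    simp
  have hcount : ∀ ω, ((Finset.univ.filter (fun i => Y i ω ∈ B i)).card : ℝ) =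
      (∑ i, fun ω => (B i).indicator (fun _ => (1 : ℝ)) (Y i ω)) ω := by
    intro ω
    simp [Finset.sum_apply, Set.indicator_apply]
  simp_rw [hcount]
  have hint : Integrable (fun ω => Real.exp (1 * (∑ i, fun ω =>
      (B i).indicator (fun _ => (1 : ℝ)) (Y i ω)) ω)) P := by
    refine Integrable.of_mem_Icc 0 (Real.exp (Fintype.card ι)) (Real.measurable_exp.comp
      (hsum.const_mul _)).aemeasurable ?_
    refine Filter.Eventually.of_forall fun ω => ⟨(Real.exp_pos _).le, Real.exp_le_exp.2 ?_⟩
    rw [one_mul, ← hcount]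
    exact_mod_cast Finset.card_le_univ _
  refine (measure_ge_le_exp_mul_mgf T zero_le_one hint).trans ?_
  refine (mul_le_mul_of_nonneg_left (mgf_count_le mY hY hB 1) (Real.exp_pos _).le).trans ?_
  rw [← Real.exp_add]
  refine Real.exp_le_exp.2 ?_
  have he := Real.exp_one_lt_d9
  have h0 : 0 ≤ ∑ i, P.real (Y i ⁻¹' B i) := Finset.sum_nonneg fun i _ => measureReal_nonneg
  nlinarith

open Classical in
/-- Chernoff bound: half the expected number of events is rarely missed. -/
lemma count_le_le {ι : Type*} [Fintype ι] [IsProbabilityMeasure P] {β : ι → Type*}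
    [∀ i, MeasurableSpace (β i)] {Y : ∀ i, Ω → β i} (mY : ∀ i, Measurable (Y i))
    (hY : iIndepFun Y P) {B : ∀ i, Set (β i)} (hB : ∀ i, MeasurableSet (B i)) {T : ℝ}
    (hT0 : 0 ≤ T) (hT : T ≤ ∑ i, P.real (Y i ⁻¹' B i)) :
    P.real {ω | ((Finset.univ.filter (fun i => Y i ω ∈ B i)).card : ℝ) ≤ T / 2} ≤
      Real.exp (-T / 8) := by
  have hmeas : ∀ i, Measurable (fun ω => (B i).indicator (fun _ => (1 : ℝ)) (Y i ω)) := fun i =>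
    (measurable_const.indicator (hB i)).comp (mY i)
  have hsum : Measurable (∑ i, fun ω => (B i).indicator (fun _ => (1 : ℝ)) (Y i ω)) := by
    convert Finset.univ.measurable_sum fun i _ => hmeas i using 1
    ext ω
    simp
  have hcount : ∀ ω, ((Finset.univ.filter (fun i => Y i ω ∈ B i)).card : ℝ) =
      (∑ i, fun ω => (B i).indicator (fun _ => (1 : ℝ)) (Y i ω)) ω := by
    intro ω
    simp [Finset.sum_apply, Set.indicator_apply]
  simp_rw [hcount]
  have hint : Integrable (fun ω => Real.exp (-1 * (∑ i, fun ω =>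
      (B i).indicator (fun _ => (1 : ℝ)) (Y i ω)) ω)) P := by
    refine Integrable.of_mem_Icc 0 1 (Real.measurable_exp.comp
      (hsum.const_mul _)).aemeasurable ?_
    refine Filter.Eventually.of_forall fun ω => ⟨(Real.exp_pos _).le, ?_⟩
    rw [← hcount, Real.exp_le_one_iff]
    have : (0 : ℝ) ≤ ((Finset.univ.filter (fun i => Y i ω ∈ B i)).card : ℝ) := Nat.cast_nonneg _
    linarith
  refine (measure_le_le_exp_mul_mgf (T / 2) (by norm_num) hint).trans ?_
  refine (mul_le_mul_of_nonneg_left (mgf_count_le mY hY hB (-1)) (Real.exp_pos _).le).trans ?_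
  rw [← Real.exp_add]
  refine Real.exp_le_exp.2 ?_
  have he : Real.exp (-1) ≤ 3 / 8 := by
    rw [Real.exp_neg, inv_le_comm₀ (Real.exp_pos _) (by norm_num)]
    have := Real.exp_one_gt_d9
    linarith
  nlinarith

end Independence

/-! ### Sign flips and Hoeffding bounds -/

/-- Independent symmetric real random variables, almost surely bounded by `C`. -/
structure IsSymmFamily {κ Ω : Type*} [MeasurableSpace Ω] (C : ℝ) (P : Measure Ω)
    (X : κ → Ω → ℝ) : Prop where
  measurable : ∀ j, Measurable (X j)
  indep : iIndepFun X P
  symm : ∀ j, P.map (fun ω => -X j ω) = P.map (X j)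
  bound : ∀ j, ∀ᵐ ω ∂P, |X j ω| ≤ C

section Flips

variable {m : ℕ}

/-- Change the sign of the coordinates `j ∈ F` with `j < t`. -/
def partialFlip (F : Finset (Fin m)) (t : ℕ) (x : Fin m → ℝ) : Fin m → ℝ :=
  fun j => (if j ∈ F ∧ j.1 < t then -1 else 1) * x j

lemma partialFlip_of_notMem {F : Finset (Fin m)} {t : ℕ} {x : Fin m → ℝ} {j : Fin m}
    (hj : j ∉ F) : partialFlip F t x j = x j := by
  simp [partialFlip, hj]

/-- Discrete intermediate value theorem: a sequence with steps at most `2 θ` passes every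
intermediate value within distance `θ`. -/
lemma exists_near_of_crossing {f : ℕ → ℝ} {u θ : ℝ} (m : ℕ) (h0 : u ≤ f 0) (hm : f m ≤ u)
    (hθ : 0 ≤ θ) (hstep : ∀ t < m, |f (t + 1) - f t| ≤ 2 * θ) : ∃ t ≤ m, |f t - u| ≤ θ := by
  induction m with
  | zero => exact ⟨0, le_rfl, by rw [le_antisymm hm h0]; simpa using hθ⟩
  | succ m ih =>
    by_cases h : f m ≤ u
    · obtain ⟨t, ht, h'⟩ := ih h fun t ht => hstep t (by omega)
      exact ⟨t, by omega, h'⟩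
    · push Not at h
      have h1 := abs_le.1 (hstep m (by omega))
      by_cases h2 : f m - u ≤ θ
      · exact ⟨m, by omega, by rw [abs_of_nonneg (by linarith)]; exact h2⟩
      · exact ⟨m + 1, le_rfl, by rw [abs_le]; constructor <;> linarith⟩

/-- As the signs of the coordinates in `F` are changed one after the other, the sum over `F` turns
into its negative in steps of size at most `2 θ`, so its absolute value comes within `θ` of every
value between `0` and where it started. -/
lemma exists_partialFlip_near (F : Finset (Fin m)) (a x : Fin m → ℝ) {u θ : ℝ} (hθ : 0 ≤ θ)
    (hax : ∀ j ∈ F, |a j * x j| ≤ θ) (hu0 : 0 ≤ u) (hu : u ≤ |∑ j ∈ F, a j * x j|) :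
    ∃ t ≤ m, |(|∑ j ∈ F, a j * partialFlip F t x j|) - u| ≤ θ := by
  have key : ∀ b : Fin m → ℝ, (∀ j ∈ F, |b j * x j| ≤ θ) → u ≤ ∑ j ∈ F, b j * x j →
      ∃ t ≤ m, |(|∑ j ∈ F, b j * partialFlip F t x j|) - u| ≤ θ := by
    intro b hb hub
    obtain ⟨t, ht, h⟩ := exists_near_of_crossing
      (f := fun t => ∑ j ∈ F, b j * partialFlip F t x j) (u := u) (θ := θ) m
      (by simpa [partialFlip] using hub)
      (by
        have : ∑ j ∈ F, b j * partialFlip F m x j = -∑ j ∈ F, b j * x j := by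
          rw [← Finset.sum_neg_distrib]
          exact Finset.sum_congr rfl fun j hj => by simp [partialFlip, hj]
        simp only [this]; linarith) hθ
      (by
        intro t ht
        rw [← Finset.sum_sub_distrib]
        by_cases hF : (⟨t, ht⟩ : Fin m) ∈ F
        · rw [Finset.sum_eq_single_of_mem _ hF]
          · have := hb _ hF
            simp only [partialFlip, hF, true_and, lt_add_one, if_true, lt_irrefl, if_false]
            rw [show b ⟨t, ht⟩ * (-1 * x ⟨t, ht⟩) - b ⟨t, ht⟩ * (1 * x ⟨t, ht⟩) =
              -2 * (b ⟨t, ht⟩ * x ⟨t, ht⟩) by ring, abs_mul]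
            norm_num
            rwa [← abs_mul]
          · intro j hj hne
            have : j.1 < t + 1 ↔ j.1 < t := by
              have : j.1 ≠ t := fun h => hne (Fin.ext h)
              omega
            simp [partialFlip, this]
        · rw [Finset.sum_eq_zero]
          · simpa using hθ
          · intro j hj
            have : j.1 < t + 1 ↔ j.1 < t := by
              have : j.1 ≠ t := fun h => hF ((Fin.ext h : j = ⟨t, ht⟩) ▸ hj)
              omega
            simp [partialFlip, this])
    refine ⟨t, ht, ?_⟩
    have := abs_abs_sub_abs_le (∑ j ∈ F, b j * partialFlip F t x j) u
    rw [abs_of_nonneg hu0] at this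
    exact this.trans h
  rcases le_total 0 (∑ j ∈ F, a j * x j) with h | h
  · exact key a hax (by rwa [abs_of_nonneg h] at hu)
  · obtain ⟨t, ht, h'⟩ := key (fun j => -a j) (fun j hj => by simpa using hax j hj)
      (by rw [abs_of_nonpos h] at hu; simpa using hu)
    exact ⟨t, ht, by simpa using h'⟩

variable {Ω : Type*} [MeasurableSpace Ω] {P : Measure Ω} {C : ℝ} [IsProbabilityMeasure P]

lemma IsSymmFamily.measureReal_signs {κ : Type*} [Fintype κ] {X : κ → Ω → ℝ}
    (h : IsSymmFamily C P X) {s : κ → ℝ} (hs : ∀ j, s j = 1 ∨ s j = -1) {B : Set (κ → ℝ)}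
    (hB : MeasurableSet B) :
    P.real {ω | (fun j => s j * X j ω) ∈ B} = P.real {ω | (fun j => X j ω) ∈ B} := by
  have := map_signs_eq h.measurable h.indep h.symm hs
  have hm := h.measurable
  have h1 := congrArg (fun ν => ν B) this
  rw [Measure.map_apply (by fun_prop) hB, Measure.map_apply (by fun_prop) hB] at h1
  simp only [Measure.real]
  exact congrArg ENNReal.toReal h1

/-- If every `x ∈ A` has a partial flip in `B`, then, partial flips preserving the law of `X`,
`A` is at most `m + 1` times as likely as `B`. -/
lemma IsSymmFamily.measureReal_le_of_partialFlip {X : Fin m → Ω → ℝ}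
    (h : IsSymmFamily C P X) (F : Finset (Fin m)) {A B : Set (Fin m → ℝ)}
    (hB : MeasurableSet B)
    (hAB : ∀ x ∈ A, (∀ j, |x j| ≤ C) → ∃ t ≤ m, partialFlip F t x ∈ B) :
    P.real {ω | (fun j => X j ω) ∈ A} ≤ (m + 1) * P.real {ω | (fun j => X j ω) ∈ B} := by
  have hb : ∀ᵐ ω ∂P, ∀ j, |X j ω| ≤ C := ae_all_iff.2 h.bound
  have h1 : P.real {ω | (fun j => X j ω) ∈ A} ≤
      P.real (⋃ t ∈ Finset.range (m + 1), {ω | partialFlip F t (fun j => X j ω) ∈ B}) := by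
    refine ENNReal.toReal_mono (measure_ne_top _ _) (measure_mono_ae ?_)
    filter_upwards [hb] with ω hω hA
    obtain ⟨t, ht, hB⟩ := hAB _ hA hω
    exact Set.mem_biUnion (x := t) (by simpa using Nat.lt_succ_of_le ht) hB
  refine h1.trans ((measureReal_biUnion_finset_le _ _).trans ?_)
  have h2 : ∀ t, P.real {ω | partialFlip F t (fun j => X j ω) ∈ B} =
      P.real {ω | (fun j => X j ω) ∈ B} := fun t =>
    h.measureReal_signs (s := fun j => if j ∈ F ∧ j.1 < t then -1 else 1)
      (fun j => by split_ifs <;> simp) hB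
  simp [h2]

end Flips

section Hoeffding

lemma integral_eq_zero_of_map_neg {Ω : Type*} [MeasurableSpace Ω] {P : Measure Ω} {Y : Ω → ℝ}
     (mY : Measurable Y)
    (h : P.map (fun ω => -Y ω) = P.map Y) : ∫ ω, Y ω ∂P = 0 := by
  have h1 : ∫ t, t ∂(P.map Y) = ∫ ω, Y ω ∂P := integral_map mY.aemeasurable (by fun_prop)
  have h2 : ∫ t, t ∂(P.map (fun ω => -Y ω)) = ∫ ω, -Y ω ∂P :=
    integral_map mY.neg.aemeasurable (by fun_prop)
  rw [h, h1, integral_neg] at h2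
  linarith

variable {Ω : Type*} [MeasurableSpace Ω] {P : Measure Ω} {C : ℝ} [IsProbabilityMeasure P]

/-- Two-sided Hoeffding inequality for bounded centred variables. For `σ = 0` the right-hand side is
`2`, by the convention `t ^ 2 / 0 = 0`. -/
lemma hoeffding_two_sided {ι : Type*} {Y : ι → Ω → ℝ} (hY : iIndepFun Y P)
    (mY : ∀ i, Measurable (Y i)) {s : Finset ι} {c : ι → ℝ}
    (hb : ∀ i ∈ s, ∀ᵐ ω ∂P, |Y i ω| ≤ c i) (h0 : ∀ i ∈ s, ∫ ω, Y i ω ∂P = 0) {σ t : ℝ}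
    (hσ : ∑ i ∈ s, c i ^ 2 ≤ σ) (ht : 0 ≤ t) :
    P.real {ω | t ≤ |∑ i ∈ s, Y i ω|} ≤ 2 * Real.exp (-(t ^ 2 / (2 * σ))) := by
  have key : ∀ Z : ι → Ω → ℝ, iIndepFun Z P → (∀ i, Measurable (Z i)) →
      (∀ i ∈ s, ∀ᵐ ω ∂P, |Z i ω| ≤ c i) → (∀ i ∈ s, ∫ ω, Z i ω ∂P = 0) →
      P.real {ω | t ≤ ∑ i ∈ s, Z i ω} ≤ Real.exp (-(t ^ 2 / (2 * σ))) := by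
    intro Z hZ mZ hbZ h0Z
    have hs : ∀ i ∈ s, HasSubgaussianMGF (Z i) ((‖c i - -c i‖₊ / 2) ^ 2) P := fun i hi =>
      hasSubgaussianMGF_of_mem_Icc_of_integral_eq_zero (mZ i).aemeasurable
        ((hbZ i hi).mono fun ω h => abs_le.1 h) (h0Z i hi)
    have h1 := (HasSubgaussianMGF.sum_of_iIndepFun hZ hs).measure_ge_le ht
    have hc : ((∑ i ∈ s, (‖c i - -c i‖₊ / 2) ^ 2 : NNReal) : ℝ) = ∑ i ∈ s, c i ^ 2 := by
      push_cast
      refine Finset.sum_congr rfl fun i _ => ?_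
      rw [Real.norm_eq_abs, div_pow, sq_abs]
      ring
    rw [hc] at h1
    rcases (Finset.sum_nonneg fun i (_ : i ∈ s) => sq_nonneg (c i)).eq_or_lt with hz | hz
    · -- all `c i` vanish, so the sum is almost surely zero
      have hci : ∀ i ∈ s, c i = 0 := fun i hi => by
        have := (Finset.sum_eq_zero_iff_of_nonneg fun i _ => sq_nonneg (c i)).1 hz.symm i hi
        simpa using this
      have hae : ∀ᵐ ω ∂P, ∑ i ∈ s, Z i ω = 0 := by
        have : ∀ᵐ ω ∂P, ∀ i ∈ s, |Z i ω| ≤ c i := (ae_ball_iff s.countable_toSet).2 hbZ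
        filter_upwards [this] with ω hω
        refine Finset.sum_eq_zero fun i hi => ?_
        have := hω i hi
        rw [hci i hi] at this
        exact abs_nonpos_iff.1 this
      rcases ht.eq_or_lt with ht0 | ht0
      · rw [← ht0]
        simp
      · have : P.real {ω | t ≤ ∑ i ∈ s, Z i ω} = 0 := by
          rw [measureReal_eq_zero_iff]
          refine measure_mono_null (t := {ω | ¬ (∑ i ∈ s, Z i ω = 0)}) ?_ (ae_iff.1 hae)
          intro ω hω h
          simp only [Set.mem_ofPred_eq] at hω h
          linarith
        rw [this]; positivity
    · refine h1.trans (Real.exp_le_exp.2 ?_)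
      rw [neg_div, neg_le_neg_iff]
      gcongr
  have h1 := key Y hY mY hb h0
  have h2 := key (fun i ω => -Y i ω) (hY.comp (fun _ t => -t) fun _ => measurable_neg)
    (fun i => (mY i).neg) (fun i hi => by simpa using hb i hi)
    (fun i hi => by rw [integral_neg, h0 i hi, neg_zero])
  have h3 : {ω | t ≤ |∑ i ∈ s, Y i ω|} ⊆
      {ω | t ≤ ∑ i ∈ s, Y i ω} ∪ {ω | t ≤ ∑ i ∈ s, -Y i ω} := by
    intro ω hω
    simpa [le_abs] using hω
  calc _ ≤ _ := measureReal_mono h3 (measure_ne_top _ _)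
    _ ≤ _ := measureReal_union_le _ _
    _ ≤ _ := by linarith

lemma IsSymmFamily.hoeffding {κ : Type*} {X : κ → Ω → ℝ} (h : IsSymmFamily C P X)
    (s : Finset κ) (a : κ → ℝ) {σ t : ℝ} (hσ : ∑ j ∈ s, a j ^ 2 ≤ σ)
    (ht : 0 ≤ t) :
    P.real {ω | t ≤ |∑ j ∈ s, a j * X j ω|} ≤ 2 * Real.exp (-(t ^ 2 / (2 * (C ^ 2 * σ)))) := by
  refine hoeffding_two_sided (c := fun j => C * |a j|)
    (h.indep.comp (fun j t => a j * t) fun j => measurable_const_mul _)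
    (fun j => (h.measurable j).const_mul _) (fun j _ => ?_) (fun j _ => ?_) ?_ ht
  · filter_upwards [h.bound j] with ω hω
    rw [Function.comp_apply, abs_mul, mul_comm]
    gcongr
  · change ∫ ω, a j * X j ω ∂P = 0
    rw [integral_const_mul, integral_eq_zero_of_map_neg (h.measurable j) (h.symm j), mul_zero]
  · simp_rw [mul_pow, sq_abs]
    rw [← Finset.mul_sum]
    gcongr

end Hoeffding

/-! ### Consequences of the restricted isometry property -/

section Geometry

variable {n m k : ℕ} {A : Matrix (Fin n) (Fin m) ℝ} {δ : ℝ}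

lemma apply_eq_sum (A : Matrix (Fin n) (Fin m) ℝ) (x : Fin m → ℝ) :
    apply A x = ∑ j, x j • column A j := by
  ext l
  simp [apply, column, Matrix.mulVec, dotProduct, mul_comm]

lemma inner_apply (A : Matrix (Fin n) (Fin m) ℝ) (z : Vec n) (x : Fin m → ℝ) :
    ⟪z, apply A x⟫_ℝ = ∑ j, ⟪z, column A j⟫_ℝ * x j := by
  rw [apply_eq_sum, inner_sum]
  exact Finset.sum_congr rfl fun j _ => by rw [real_inner_smul_right, mul_comm]

lemma norm_apply_le_of_support (hA : ∀ i, ‖column A i‖ = 1) {C : ℝ} {S : Finset (Fin m)}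
    {x : Fin m → ℝ} (hx : ∀ j, |x j| ≤ C) (hS : ∀ j, j ∉ S → x j = 0) :
    ‖apply A x‖ ≤ S.card * C := by
  rw [apply_eq_sum, ← Finset.sum_subset (Finset.subset_univ S)
    (fun j _ hj => by rw [hS j hj, zero_smul])]
  refine (norm_sum_le _ _).trans ((Finset.sum_le_card_nsmul _ _ C fun j _ => ?_).trans ?_)
  · rw [norm_smul, hA, mul_one]
    exact hx j
  · simp

lemma IsRIP.norm_sq_sum (hR : IsRIP k δ A) (hδ1 : δ ≤ 1) {S : Finset (Fin m)}
    (hS : S.card ≤ k) (w : Fin m → ℝ) :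
    (1 - δ) ^ 2 * ∑ j ∈ S, w j ^ 2 ≤ ‖∑ j ∈ S, w j • column A j‖ ^ 2 ∧
      ‖∑ j ∈ S, w j • column A j‖ ^ 2 ≤ (1 + δ) ^ 2 * ∑ j ∈ S, w j ^ 2 := by
  classical
  set x : Fin m → ℝ := fun j => if j ∈ S then w j else 0 with hx
  have hcard : {i | x i ≠ 0}.ncard ≤ k := by
    refine le_trans ?_ hS
    rw [← Set.ncard_coe_finset S]
    refine Set.ncard_le_ncard (fun j hj => ?_) S.finite_toSet
    by_contra h
    exact hj (by simp only [hx]; rw [if_neg]; simpa using h)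
  have h1 : apply A x = ∑ j ∈ S, w j • column A j := by
    rw [apply_eq_sum]
    simp [hx, ite_smul, Finset.sum_ite_mem]
  have h2 : ‖(WithLp.toLp 2 x : Vec m)‖ ^ 2 = ∑ j ∈ S, w j ^ 2 := by
    rw [EuclideanSpace.norm_sq_eq]
    simp [hx, ite_pow, Finset.sum_ite_mem]
  obtain ⟨h3, h4⟩ := hR x hcard
  rw [h1] at h3 h4
  rw [← h2, ← mul_pow, ← mul_pow]
  exact ⟨pow_le_pow_left₀ (mul_nonneg (by linarith) (norm_nonneg _)) h3 2,
    pow_le_pow_left₀ (norm_nonneg _) h4 2⟩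

lemma IsRIP.nonneg (hR : IsRIP k δ A) (hk : 1 ≤ k) (hA : ∀ i, ‖column A i‖ = 1) (i : Fin m) :
    0 ≤ δ := by
  have h : {j | (Pi.single i 1 : Fin m → ℝ) j ≠ 0}.ncard ≤ k := by
    refine le_trans ?_ hk
    rw [← Set.ncard_singleton i]
    refine Set.ncard_le_ncard (fun j hj => ?_) (Set.finite_singleton i)
    by_contra h
    exact hj (Pi.single_eq_of_ne h _)
  have h1 := (hR _ h).2
  have h2 : apply A (Pi.single i 1) = column A i := by
    rw [apply_eq_sum, Finset.sum_eq_single_of_mem i (Finset.mem_univ _)]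
    · simp
    · intro j _ hj
      simp [hj]
  have h3 : ‖(WithLp.toLp 2 (Pi.single i (1 : ℝ)) : Vec m)‖ = 1 := by
    change ‖EuclideanSpace.single i (1 : ℝ)‖ = 1
    simp
  rw [h2, hA, h3] at h1
  linarith

/-- Bessel-type bound: the correlations of `e` with at most `k` columns. -/
lemma IsRIP.sum_inner_sq_le (hR : IsRIP k δ A) (hδ0 : 0 ≤ δ) (hδ1 : δ ≤ 1) {S : Finset (Fin m)}
    (hS : S.card ≤ k) (e : Vec n) :
    ∑ j ∈ S, ⟪e, column A j⟫_ℝ ^ 2 ≤ (1 + δ) ^ 2 * ‖e‖ ^ 2 := by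
  set w : Fin m → ℝ := fun j => ⟪e, column A j⟫_ℝ with hw
  have h1 := (hR.norm_sq_sum hδ1 hS w).2
  have h2 : ⟪e, ∑ j ∈ S, w j • column A j⟫_ℝ = ∑ j ∈ S, w j ^ 2 := by
    rw [inner_sum]
    exact Finset.sum_congr rfl fun j _ => by rw [real_inner_smul_right, sq]
  have h3 := real_inner_mul_inner_self_le e (∑ j ∈ S, w j • column A j)
  rw [h2, real_inner_self_eq_norm_sq, real_inner_self_eq_norm_sq] at h3
  have h0 : 0 ≤ ∑ j ∈ S, w j ^ 2 := Finset.sum_nonneg fun j _ => sq_nonneg _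
  rcases h0.eq_or_lt with h | h
  · rw [← h]; positivity
  · have h4 : (∑ j ∈ S, w j ^ 2) * ∑ j ∈ S, w j ^ 2 ≤
        ((1 + δ) ^ 2 * ‖e‖ ^ 2) * ∑ j ∈ S, w j ^ 2 := by
      refine h3.trans ?_
      rw [mul_right_comm, mul_comm _ (‖e‖ ^ 2)]
      exact mul_le_mul_of_nonneg_left h1 (sq_nonneg _)
    exact le_of_mul_le_mul_right h4 h

/-- Apply the lower isometry bound to `A i - ∑ j ∈ S, ⟨A i, A j⟩ A j`. -/
lemma IsRIP.sum_inner_column_sq_le_of_card_lt (hR : IsRIP k δ A) (hδ0 : 0 ≤ δ)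
    (hδ1 : δ ≤ 1 / 4) (hA : ∀ i, ‖column A i‖ = 1) {i : Fin m} {S : Finset (Fin m)}
    (hi : i ∉ S) (hS : S.card + 1 ≤ k) :
    ∑ j ∈ S, ⟪column A i, column A j⟫_ℝ ^ 2 ≤ 2 * δ := by
  classical
  set w : Fin m → ℝ := fun j => ⟪column A i, column A j⟫_ℝ with hw
  set v := ∑ j ∈ S, w j • column A j with hv
  set V := ∑ j ∈ S, w j ^ 2 with hV
  have h1 := (hR.norm_sq_sum (by linarith) (by omega : S.card ≤ k) w).2
  have h2 : ⟪column A i, v⟫_ℝ = V := by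
    rw [hv, inner_sum]
    exact Finset.sum_congr rfl fun j _ => by rw [real_inner_smul_right, sq]
  have hw' : ∀ j ∈ S, (if j = i then 1 else -w j) = -w j := fun j hj =>
    if_neg (fun h : j = i => hi (h ▸ hj))
  have h3 := (hR.norm_sq_sum (by linarith) (S := insert i S)
    (by rw [Finset.card_insert_of_notMem hi]; exact hS) (fun j => if j = i then 1 else -w j)).1
  rw [Finset.sum_insert hi, Finset.sum_insert hi,
    Finset.sum_congr rfl (fun j hj => by rw [hw' j hj, neg_sq]),
    Finset.sum_congr (s₁ := S) (g := fun j => -(w j • column A j)) rfl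
      (fun j hj => by rw [hw' j hj, neg_smul]), Finset.sum_neg_distrib, if_pos rfl, one_smul,
    ← sub_eq_add_neg, norm_sub_sq_real, h2, hA] at h3
  have h0 : 0 ≤ V := Finset.sum_nonneg fun j _ => sq_nonneg _
  nlinarith

lemma IsRIP.abs_inner_column_le (hR : IsRIP k δ A) (hk : 2 ≤ k) (hδ0 : 0 ≤ δ) (hδ1 : δ ≤ 1)
    (hA : ∀ i, ‖column A i‖ = 1) {i j : Fin m} (hij : i ≠ j) :
    |⟪column A i, column A j⟫_ℝ| ≤ 3 * δ := by
  classical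
  have hc : ({i, j} : Finset (Fin m)).card ≤ k := (Finset.card_le_two).trans hk
  have h1 := (hR.norm_sq_sum hδ1 hc (fun _ => 1)).2
  have h2 := (hR.norm_sq_sum hδ1 hc (fun l => if l = i then 1 else -1)).2
  rw [Finset.sum_pair hij, Finset.sum_pair hij] at h1 h2
  simp only [one_smul, if_pos, if_neg hij.symm, neg_smul, ← sub_eq_add_neg, norm_add_sq_real,
    norm_sub_sq_real, hA] at h1 h2
  rw [abs_le]
  constructor <;> nlinarith

/-- The correlations of one column with at most `k` others. When `#S = k` the column `i` together
with `S` exceeds the sparsity `k`, so one element of `S` is split off. -/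
lemma IsRIP.sum_inner_column_sq_le (hR : IsRIP k δ A) (hk : 2 ≤ k) (hδ0 : 0 ≤ δ)
    (hδ1 : δ ≤ 1 / 9) (hA : ∀ i, ‖column A i‖ = 1) {i : Fin m} {S : Finset (Fin m)}
    (hi : i ∉ S) (hS : S.card ≤ k) :
    ∑ j ∈ S, ⟪column A i, column A j⟫_ℝ ^ 2 ≤ 3 * δ := by
  classical
  rcases S.eq_empty_or_nonempty with rfl | ⟨l, hl⟩
  · simpa using hδ0
  · have h1 := hR.sum_inner_column_sq_le_of_card_lt hδ0 (by linarith) hA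
      (S := S.erase l) (fun h => hi (Finset.mem_of_mem_erase h))
      (by rw [Finset.card_erase_add_one hl]; exact hS)
    have h2 := hR.abs_inner_column_le hk hδ0 (by linarith) hA (i := i) (j := l)
      (fun h => hi (h ▸ hl))
    rw [← Finset.add_sum_erase S _ hl]
    have h3 := sq_le_sq' (abs_le.1 h2).1 (abs_le.1 h2).2
    nlinarith

lemma norm_sub_smul_column_sq (hA : ∀ i, ‖column A i‖ = 1) {z : Vec n} (hz : ‖z‖ = 1)
    (i : Fin m) {b : ℝ} (hb : b = -1 ∨ b = 1) :
    ‖z - b • column A i‖ ^ 2 = 2 - 2 * (b * ⟪z, column A i⟫_ℝ) := by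
  rw [norm_sub_sq_real, norm_smul, hA, hz, real_inner_smul_right]
  rcases hb with rfl | rfl <;> norm_num <;> ring

/-- If `z` is close to `± A i`, its correlations with at most `k` other columns are small. -/
lemma IsRIP.sum_inner_sq_le_of_near (hR : IsRIP k δ A) (hk : 2 ≤ k) (hδ0 : 0 ≤ δ)
    (hδ1 : δ ≤ 1 / 9) (hA : ∀ i, ‖column A i‖ = 1) {i : Fin m} {S : Finset (Fin m)}
    (hi : i ∉ S) (hS : S.card ≤ k) {z : Vec n} {b ρ : ℝ} (hb : b = -1 ∨ b = 1)
    (hz : ‖z - b • column A i‖ ^ 2 ≤ ρ) :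
    ∑ j ∈ S, ⟪z, column A j⟫_ℝ ^ 2 ≤ 3 * ρ + 6 * δ := by
  have h1 := hR.sum_inner_sq_le hδ0 (by linarith) hS (z - b • column A i)
  have h2 := hR.sum_inner_column_sq_le hk hδ0 hδ1 hA hi hS
  have h3 : ∀ j ∈ S, ⟪z, column A j⟫_ℝ ^ 2 ≤
      2 * ⟪z - b • column A i, column A j⟫_ℝ ^ 2 + 2 * ⟪column A i, column A j⟫_ℝ ^ 2 := by
    intro j _
    rw [inner_sub_left, real_inner_smul_left]
    have hb2 : b ^ 2 = 1 := by rcases hb with rfl | rfl <;> norm_num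
    nlinarith [sq_nonneg (⟪z, column A j⟫_ℝ - 2 * (b * ⟪column A i, column A j⟫_ℝ)),
      mul_pow b ⟪column A i, column A j⟫_ℝ 2]
  have h4 := Finset.sum_le_sum h3
  rw [Finset.sum_add_distrib, ← Finset.mul_sum, ← Finset.mul_sum] at h4
  have h5 : (1 + δ) ^ 2 * ‖z - b • column A i‖ ^ 2 ≤ 3 / 2 * ρ := by
    have : (1 + δ) ^ 2 ≤ 3 / 2 := by nlinarith
    exact mul_le_mul this hz (sq_nonneg _) (by norm_num)
  linarith

/-- A unit vector is correlated with few of the nearly orthogonal columns: test it against the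
signed sum of those columns. -/
lemma IsRIP.card_le_of_le_abs_inner (hR : IsRIP k δ A) (hk : 2 ≤ k) (hδ0 : 0 ≤ δ) (hδ1 : δ ≤ 1)
    (hA : ∀ i, ‖column A i‖ = 1) {z : Vec n} (hz : ‖z‖ = 1) {θ : ℝ} (hθ : 0 ≤ θ)
    {T : Finset (Fin m)} (hT : ∀ j ∈ T, θ ≤ |⟪z, column A j⟫_ℝ|) :
    (T.card : ℝ) * (θ ^ 2 - 3 * δ) ≤ 1 := by
  classical
  set s : Fin m → ℝ := fun j => SignType.sign ⟪z, column A j⟫_ℝ with hs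
  set v := ∑ j ∈ T, s j • column A j with hv
  have hs1 : ∀ j, |s j| ≤ 1 := by
    intro j
    simp only [hs]
    rcases SignType.trichotomy (SignType.sign ⟪z, column A j⟫_ℝ) with h | h | h <;> simp [h]
  have h1 : T.card * θ ≤ ⟪z, v⟫_ℝ := by
    rw [hv, inner_sum, ← nsmul_eq_mul]
    refine Finset.card_nsmul_le_sum _ _ _ fun j hj => ?_
    rw [real_inner_smul_right, hs, sign_mul_self]
    exact hT j hj
  have h2 : ⟪z, v⟫_ℝ ≤ ‖v‖ := by
    have := real_inner_le_norm z v
    rwa [hz, one_mul] at this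
  have h3 : ‖v‖ ^ 2 ≤ T.card + T.card ^ 2 * (3 * δ) := by
    have h4 : ∀ i ∈ T, ∑ j ∈ T, s i * (s j * ⟪column A i, column A j⟫_ℝ) ≤
        1 + T.card * (3 * δ) := by
      intro i hi
      rw [← Finset.add_sum_erase T _ hi]
      refine add_le_add ?_ ?_
      · rw [real_inner_self_eq_norm_sq, hA]
        have := hs1 i
        nlinarith [sq_abs (s i), abs_nonneg (s i)]
      · refine (Finset.sum_le_card_nsmul _ _ (3 * δ) fun j hj => ?_).trans ?_
        · refine (le_abs_self _).trans ?_
          rw [abs_mul, abs_mul]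
          have h5 := hR.abs_inner_column_le hk hδ0 hδ1 hA (Finset.ne_of_mem_erase hj).symm
          calc |s i| * (|s j| * |⟪column A i, column A j⟫_ℝ|)
              ≤ 1 * (1 * (3 * δ)) := by
                gcongr
                · exact hs1 i
                · exact hs1 j
            _ = 3 * δ := by ring
        · rw [nsmul_eq_mul]
          gcongr
          exact Finset.erase_subset _ _
    rw [← real_inner_self_eq_norm_sq, hv, sum_inner]
    simp_rw [inner_sum, real_inner_smul_left, real_inner_smul_right]
    refine (Finset.sum_le_card_nsmul _ _ _ h4).trans (le_of_eq ?_)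
    rw [nsmul_eq_mul]; ring
  have h0 : (0 : ℝ) ≤ T.card := Nat.cast_nonneg _
  rcases h0.eq_or_lt with h | h
  · rw [← h]; norm_num
  · have h4 : (T.card * θ) ^ 2 ≤ ‖v‖ ^ 2 :=
      pow_le_pow_left₀ (by positivity) (h1.trans h2) 2
    have h5 : (T.card : ℝ) * (T.card * (θ ^ 2 - 3 * δ)) ≤ T.card * 1 := by nlinarith
    exact le_of_mul_le_mul_left h5 h

/-- Normalizing `α e + u` recovers the unit vector `e` up to twice the relative error. -/
lemma norm_normalize_sub_le {E : Type*} [NormedAddCommGroup E] [NormedSpace ℝ E]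
    {e u : E} (he : ‖e‖ = 1) {α : ℝ} (hα : 0 < α) (hu : ‖u‖ < α) :
    ‖‖α • e + u‖⁻¹ • (α • e + u) - e‖ ≤ 2 * ‖u‖ / α := by
  set v := α • e + u with hv
  have hαe : ‖α • e‖ = α := by rw [norm_smul, he, mul_one, Real.norm_of_nonneg hα.le]
  have h1 : |‖v‖ - α| ≤ ‖u‖ := by
    have := abs_norm_sub_norm_le v (α • e)
    rwa [hαe, hv, add_sub_cancel_left] at this
  have hv0 : 0 < ‖v‖ := by linarith [(abs_le.1 h1).1]
  have h2 : ‖v‖⁻¹ • v - e = (‖v‖⁻¹ - α⁻¹) • v + α⁻¹ • u := by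
    have : e = α⁻¹ • (v - u) := by
      rw [hv, add_sub_cancel_right, smul_smul, inv_mul_cancel₀ hα.ne', one_smul]
    calc ‖v‖⁻¹ • v - e = ‖v‖⁻¹ • v - α⁻¹ • (v - u) := by rw [← this]
      _ = _ := by module
  have h3 : |‖v‖⁻¹ - α⁻¹| * ‖v‖ = |‖v‖ - α| / α := by
    rw [← abs_of_pos hv0, ← abs_mul, abs_of_pos hv0, ← abs_of_pos hα, ← abs_div, abs_of_pos hα,
      ← abs_neg]
    congr 1
    field_simp
    ring
  calc ‖‖v‖⁻¹ • v - e‖ ≤ ‖(‖v‖⁻¹ - α⁻¹) • v‖ + ‖α⁻¹ • u‖ := by rw [h2]; exact norm_add_le _ _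
    _ = |‖v‖ - α| / α + ‖u‖ / α := by
      rw [norm_smul, norm_smul, Real.norm_eq_abs, h3, Real.norm_of_nonneg (by positivity),
        inv_mul_eq_div]
    _ ≤ ‖u‖ / α + ‖u‖ / α := by gcongr
    _ = 2 * ‖u‖ / α := by ring

end Geometry

/-! ### The running time of TestColumn -/

section RunningTime

variable {n : ℕ}

@[simp] lemma Timed.value_bind {α β : Type} (p : Timed α) (f : α → Timed β) :
    (p >>= f).value = (f p.value).value := rfl

@[simp] lemma Timed.steps_bind {α β : Type} (p : Timed α) (f : α → Timed β) :
    (p >>= f).steps = p.steps + (f p.value).steps := rfl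

@[simp] lemma Timed.value_pure {α : Type} (a : α) : (pure a : Timed α).value = a := rfl

@[simp] lemma Timed.steps_pure {α : Type} (a : α) : (pure a : Timed α).steps = 0 := rfl

open Classical in
lemma tallyStep_value (w : ℕ) (z : Vec n) (lo hi sm : ℝ) (s : Tally n) (v : Vec n) :
    (tallyStep w z lo hi sm s v).value =
      ⟨s.high + if lo ≤ |⟪z, v⟫_ℝ| ∧ |⟪z, v⟫_ℝ| ≤ hi then 1 else 0,
        s.bad + if ¬ (lo ≤ |⟪z, v⟫_ℝ| ∧ |⟪z, v⟫_ℝ| ≤ hi) ∧ ¬ |⟪z, v⟫_ℝ| ≤ sm then 1 else 0,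
        s.num + if 1 / 2 ≤ ⟪z, v⟫_ℝ then 1 else 0,
        s.sum + if 1 / 2 ≤ ⟪z, v⟫_ℝ then v else 0⟩ := by
  by_cases h1 : lo ≤ |⟪z, v⟫_ℝ| <;> by_cases h2 : |⟪z, v⟫_ℝ| ≤ hi <;>
    by_cases h3 : |⟪z, v⟫_ℝ| ≤ sm <;> by_cases h4 : 1 / 2 ≤ ⟪z, v⟫_ℝ <;>
    simp [tallyStep, Timed.vinner, Timed.abs, Timed.le, Timed.add, Timed.vadd, h1, h2, h3, h4,
      -one_div]

lemma tallyStep_steps (w : ℕ) (z : Vec n) (lo hi sm : ℝ) (s : Tally n) (v : Vec n) :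
    (tallyStep w z lo hi sm s v).steps ≤ 2 * w + 8 := by
  by_cases h1 : lo ≤ |⟪z, v⟫_ℝ| <;> by_cases h2 : |⟪z, v⟫_ℝ| ≤ hi <;>
    by_cases h3 : |⟪z, v⟫_ℝ| ≤ sm <;> by_cases h4 : 1 / 2 ≤ ⟪z, v⟫_ℝ <;>
    simp [tallyStep, Timed.vinner, Timed.abs, Timed.le, Timed.add, Timed.vadd, h1, h2, h3, h4,
      -one_div] <;> omega

open Classical in
/-- The single pass over the samples counts and adds up what it should. -/
lemma tally_foldlM_value {ι : Type} (w : ℕ) (z : Vec n) (lo hi sm : ℝ) (y : ι → Vec n)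
    (l : List ι) (s : Tally n) :
    (l.foldlM (fun s r => tallyStep w z lo hi sm s (y r)) s).value =
      ⟨s.high + (l.map fun r =>
          if lo ≤ |⟪z, y r⟫_ℝ| ∧ |⟪z, y r⟫_ℝ| ≤ hi then (1 : ℝ) else 0).sum,
        s.bad + (l.map fun r => if ¬ (lo ≤ |⟪z, y r⟫_ℝ| ∧ |⟪z, y r⟫_ℝ| ≤ hi) ∧
          ¬ |⟪z, y r⟫_ℝ| ≤ sm then (1 : ℝ) else 0).sum,
        s.num + (l.map fun r => if 1 / 2 ≤ ⟪z, y r⟫_ℝ then (1 : ℝ) else 0).sum,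
        s.sum + (l.map fun r => if 1 / 2 ≤ ⟪z, y r⟫_ℝ then y r else 0).sum⟩ := by
  induction l generalizing s with
  | nil => simp
  | cons r l ih =>
    rw [List.foldlM_cons, Timed.value_bind, ih, tallyStep_value]
    simp only [List.map_cons, List.sum_cons, add_assoc]

lemma tally_foldlM_steps {ι : Type} (w : ℕ) (z : Vec n) (lo hi sm : ℝ) (y : ι → Vec n)
    (l : List ι) (s : Tally n) :
    (l.foldlM (fun s r => tallyStep w z lo hi sm s (y r)) s).steps ≤
      l.length * (2 * w + 8) := by
  induction l generalizing s with
  | nil => simp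
  | cons r l ih =>
    rw [List.foldlM_cons, Timed.steps_bind, List.length_cons, Nat.succ_mul, add_comm]
    exact add_le_add (ih _) (tallyStep_steps ..)

lemma testColumnProgram_value {N : ℕ} (w : ℕ) (C : ℝ) (z : Vec n) (y : Fin N → Vec n)
    (κ₀ κ₁ η : ℝ) :
    (testColumnProgram w C z y κ₀ κ₁ η).value = testColumn C z y κ₀ κ₁ η := by
  classical
  have hsel : ∀ r, 1 / 2 ≤ ⟪z, y r⟫_ℝ ↔ r ∈ selected z y := by
    intro r
    simp [selected, real_inner_comm]
  have hhigh : (∑ r, if 1 - η ≤ |⟪z, y r⟫_ℝ| ∧ |⟪z, y r⟫_ℝ| ≤ C * (1 + η) then (1 : ℝ) else 0)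
      / N = fracHigh C z y η := by
    rw [fracHigh]
    congr 1
    simp only [Set.mem_Icc, Finset.sum_boole]
  have hbad : (∑ r, if ¬ (1 - η ≤ |⟪z, y r⟫_ℝ| ∧ |⟪z, y r⟫_ℝ| ≤ C * (1 + η)) ∧
      ¬ |⟪z, y r⟫_ℝ| ≤ C * η then (1 : ℝ) else 0) / N = fracBad C z y η := by
    rw [fracBad]
    congr 1
    simp only [Finset.sum_boole, Set.mem_union, Set.mem_Icc, abs_nonneg, true_and, not_or]
  have hmean : (∑ r, if 1 / 2 ≤ ⟪z, y r⟫_ℝ then (1 : ℝ) else 0)⁻¹ •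
      (∑ r, if 1 / 2 ≤ ⟪z, y r⟫_ℝ then y r else 0) = selectedMean z y := by
    simp only [hsel, selectedMean, Finset.sum_ite_mem, Finset.univ_inter]
    simp
  simp only [testColumnProgram, Timed.value_bind, Timed.sub, Timed.add, Timed.mul, Timed.div,
    Timed.lt, Timed.le, tally_foldlM_value, zero_add, ← List.ofFn_eq_map, List.sum_ofFn, hhigh,
    hbad]
  rw [testColumn]
  by_cases h : fracBad C z y η < κ₀ ∧ κ₁ ≤ fracHigh C z y η
  · simp only [h.1, h.2, decide_true, Bool.and_self, and_self, if_true, Timed.value_bind,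
      Timed.vdiv, Timed.vnorm, Timed.value_pure, hmean]
  · have h' : (decide (fracBad C z y η < κ₀) && decide (κ₁ ≤ fracHigh C z y η)) = false := by
      rw [← Bool.not_eq_true, Bool.and_eq_true, decide_eq_true_iff, decide_eq_true_iff]
      exact h
    simp only [h', h, if_false]
    rfl

lemma testColumnProgram_steps {N : ℕ} {w : ℕ} (C : ℝ) (z : Vec n) (y : Fin N → Vec n)
    (κ₀ κ₁ η : ℝ) :
    (testColumnProgram w C z y κ₀ κ₁ η).steps ≤ N * (2 * w + 8) + 3 * w + 8 := by
  have h1 := fun lo hi sm => tally_foldlM_steps w z lo hi sm y (List.finRange N) ⟨0, 0, 0, 0⟩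
  have key : ∀ (b : Bool) {α : Type} (x y : Timed α) (c : ℕ), x.steps ≤ c → y.steps ≤ c →
      (if b then x else y).steps ≤ c := by
    intro b α x y c hx hy
    cases b <;> simpa
  simp only [List.length_finRange] at h1
  simp only [testColumnProgram, Timed.steps_bind]
  refine (add_le_add le_rfl <| add_le_add le_rfl <| add_le_add le_rfl <| add_le_add le_rfl <|
    add_le_add (h1 _ _ _) <| add_le_add le_rfl <| add_le_add le_rfl <| add_le_add le_rfl <|
    add_le_add le_rfl (key _ _ _ (w + (w + w)) le_rfl (Nat.zero_le _))).trans ?_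
  simp only [Timed.sub, Timed.add, Timed.mul, Timed.div, Timed.lt, Timed.le]
  omega

end RunningTime

/-! ### The samples, and completeness on good samples -/

section Samples

variable {N m : ℕ} {Ω : Type*} [MeasurableSpace Ω] {P : Measure Ω}
  {D : Measure ℝ} {S : Fin N → Finset (Fin m)} {x : Fin N → Fin m → Ω → ℝ} {C : ℝ}

/-- With the zero coefficients outside the supports included, the whole array of coefficients is
independent. -/
lemma IsCoeffSample.iIndepFun_all [IsProbabilityMeasure P] (h : IsCoeffSample P D S x) :
    iIndepFun (fun (p : Fin N × Fin m) ω => x p.1 p.2 ω) P :=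
  iIndepFun_of_subtype (p := fun p : Fin N × Fin m => p.2 ∈ S p.1)
    (fun p hp ω => h.zero p.1 p.2 hp ω) h.indep

lemma IsCoeffSample.iIndepFun_vectors [IsProbabilityMeasure P] (h : IsCoeffSample P D S x) :
    iIndepFun (fun r ω j => x r j ω) P :=
  iIndepFun_curry h.measurable h.iIndepFun_all

lemma IsCoeffSample.ae_mem (h : IsCoeffSample P D S x) (hD : IsSpikeSlab C D) :
    ∀ᵐ ω ∂P, ∀ r, ∀ j ∈ S r, x r j ω ∈ Set.Icc (-C) (-1) ∪ Set.Icc 1 C := by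
  refine ae_all_iff.2 fun r => ae_all_iff.2 fun j => ?_
  by_cases hj : j ∈ S r
  · have h1 := hD.supp
    rw [← h.law r j hj] at h1
    filter_upwards [ae_of_ae_map (h.measurable r j).aemeasurable h1] with ω hω _ using hω
  · exact Filter.Eventually.of_forall fun ω hj' => absurd hj' hj

lemma IsCoeffSample.isSymmFamily [IsProbabilityMeasure P] (h : IsCoeffSample P D S x)
    (hD : IsSpikeSlab C D) (hC : 0 ≤ C) (r : Fin N) : IsSymmFamily C P (x r) where
  measurable := h.measurable r
  indep := h.iIndepFun_all.precomp (g := fun j => (r, j)) (fun a b hab => by simpa using hab)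
  symm j := by
    by_cases hj : j ∈ S r
    · have h1 : P.map (fun ω => -x r j ω) = (P.map (x r j)).map (fun t => -t) :=
        (Measure.map_map measurable_neg (h.measurable r j)).symm
      rw [h1, h.law r j hj, hD.symm]
    · have h0 : ∀ ω, x r j ω = 0 := h.zero r j hj
      have h1 : x r j = fun _ => 0 := funext h0
      simp [h1]
  bound j := by
    by_cases hj : j ∈ S r
    · filter_upwards [h.ae_mem hD] with ω hω
      rw [abs_le]
      rcases hω r j hj with h1 | h1 <;> constructor <;> linarith [h1.1, h1.2]
    · exact Filter.Eventually.of_forall fun ω => by simpa [h.zero r j hj] using hC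

lemma IsCoeffSample.half_le_measureReal_pos [IsProbabilityMeasure P] (h : IsCoeffSample P D S x)
    (hD : IsSpikeSlab C D) (hC : 0 ≤ C) {r : Fin N} {i : Fin m} (hi : i ∈ S r) {b : ℝ}
    (hb : b = -1 ∨ b = 1) :
    1 / 2 ≤ P.real {ω | 0 < b * x r i ω} := by
  have hsymm : P.real {ω | 0 < -x r i ω} = P.real {ω | 0 < x r i ω} := by
    have h1 : P.map (fun ω => -x r i ω) = P.map (x r i) := (h.isSymmFamily hD hC r).symm i
    have h2 := congrArg (fun ν => ν (Set.Ioi 0)) h1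
    have hm := h.measurable r i
    rw [Measure.map_apply (by fun_prop) measurableSet_Ioi,
      Measure.map_apply (h.measurable r i) measurableSet_Ioi] at h2
    exact congrArg ENNReal.toReal h2
  have hone : 1 ≤ P.real {ω | 0 < -x r i ω} + P.real {ω | 0 < x r i ω} := by
    refine le_trans ?_ (measureReal_union_le _ _)
    rw [← probReal_univ (μ := P)]
    refine ENNReal.toReal_mono (measure_ne_top _ _) (measure_mono_ae ?_)
    filter_upwards [h.ae_mem hD] with ω hω _
    rcases hω r i hi with h1 | h1
    · left; change 0 < -x r i ω; linarith [h1.2]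
    · right; change 0 < x r i ω; linarith [h1.1]
  rcases hb with rfl | rfl
  · simp only [neg_mul, one_mul]; linarith
  · simp only [one_mul]; linarith

end Samples

section Cross

variable {n N m : ℕ}

/-- The part of `⟨z, A x⟩` contributed by the coordinates in `S` other than `i`. -/
noncomputable def cross (A : Matrix (Fin n) (Fin m) ℝ) (z : Vec n) (S : Finset (Fin m)) (i : Fin m)
    (x : Fin m → ℝ) : ℝ :=
  ∑ j ∈ S.erase i, ⟪z, column A j⟫_ℝ * x j

@[fun_prop]
lemma measurable_cross (A : Matrix (Fin n) (Fin m) ℝ) (z : Vec n) (S : Finset (Fin m))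
    (i : Fin m) : Measurable (cross A z S i) := by
  unfold cross
  fun_prop

@[fun_prop]
lemma measurable_inner_apply (A : Matrix (Fin n) (Fin m) ℝ) (z : Vec n) :
    Measurable (fun x => ⟪z, apply A x⟫_ℝ) := by
  simp_rw [inner_apply]
  fun_prop

lemma inner_apply_eq_add_cross (A : Matrix (Fin n) (Fin m) ℝ) (z : Vec n) {S : Finset (Fin m)}
    (i : Fin m) {x : Fin m → ℝ} (hx : ∀ j, j ∉ S → x j = 0) :
    ⟪z, apply A x⟫_ℝ = ⟪z, column A i⟫_ℝ * x i + cross A z S i x := by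
  rw [inner_apply, ← Finset.add_sum_erase Finset.univ _ (Finset.mem_univ i), cross]
  congr 1
  refine (Finset.sum_subset (Finset.erase_subset_erase _ (Finset.subset_univ S)) ?_).symm
  intro j hj hj'
  have : j ∉ S := fun h => hj' (Finset.mem_erase.2 ⟨Finset.ne_of_mem_erase hj, h⟩)
  rw [hx j this, mul_zero]

variable {Ω : Type*} [MeasurableSpace Ω] {P : Measure Ω} [IsProbabilityMeasure P]
  {D : Measure ℝ} {S : Fin N → Finset (Fin m)} {x : Fin N → Fin m → Ω → ℝ} {C : ℝ}
  {A : Matrix (Fin n) (Fin m) ℝ} {δ : ℝ} {k : ℕ}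

open Classical in
/-- If `z` is close to `± A i`, then few samples have a large cross term. -/
lemma cross_count_le (h : IsCoeffSample P D S x) (hD : IsSpikeSlab C D) (hC : 0 < C)
    (hS : ∀ r, (S r).card ≤ k) (hR : IsRIP k δ A) (hk : 2 ≤ k) (hδ0 : 0 ≤ δ)
    (hδ1 : δ ≤ 1 / 9) (hA : ∀ i, ‖column A i‖ = 1) {z : Vec n} {i : Fin m} {b ρ : ℝ}
    (hb : b = -1 ∨ b = 1) (hz : ‖z - b • column A i‖ ^ 2 ≤ ρ) {t σ T : ℝ}
    (ht : 0 ≤ t) (hσ : 3 * ρ + 6 * δ ≤ σ)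
    (hT : N * (2 * Real.exp (-(t ^ 2 / (2 * (C ^ 2 * σ))))) ≤ T / 2) :
    P.real {ω | T ≤ ((Finset.univ.filter
      (fun r => t ≤ |cross A z (S r) i (fun j => x r j ω)|)).card : ℝ)} ≤ Real.exp (-T / 8) := by
  refine count_ge_le (fun r => measurable_pi_lambda _ (h.measurable r)) h.iIndepFun_vectors
    (B := fun r => {y | t ≤ |cross A z (S r) i y|}) (fun r => ?_) ?_
  · exact measurableSet_le measurable_const (measurable_cross A z (S r) i).abs
  · refine le_trans ?_ hT
    refine (Finset.sum_le_card_nsmul _ _ (2 * Real.exp (-(t ^ 2 / (2 * (C ^ 2 * σ)))))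
      fun r _ => ?_).trans (by simp)
    refine (h.isSymmFamily hD hC.le r).hoeffding ((S r).erase i)
      (fun j => ⟪z, column A j⟫_ℝ) ?_ ht
    exact (hR.sum_inner_sq_le_of_near hk hδ0 hδ1 hA (Finset.notMem_erase i _)
      ((Finset.card_le_card (Finset.erase_subset _ _)).trans (hS r)) hb hz).trans hσ

end Cross

section Completeness

variable {n N m : ℕ} {A : Matrix (Fin n) (Fin m) ℝ} {C : ℝ}

open Classical in
/-- The samples with small cross term behave as if `z` were orthogonal to all columns but `A i`. -/
lemma testColumn_isSome_of_cross_count (hC : 1 ≤ C) {η : ℝ} {z : Vec n} {i : Fin m}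
    (hi : 1 - η / 2 ≤ |⟪z, column A i⟫_ℝ|) (hi1 : |⟪z, column A i⟫_ℝ| ≤ 1) (hη : 0 < η)
    (hη1 : η ≤ 1)
    (hN : 0 < N) {S : Fin N → Finset (Fin m)} {x : Fin N → Fin m → ℝ}
    (hx0 : ∀ r j, j ∉ S r → x r j = 0)
    (hx : ∀ r, ∀ j ∈ S r, x r j ∈ Set.Icc (-C) (-1) ∪ Set.Icc 1 C) {κ₀ κ₁ q : ℝ}
    (hq : q * N ≤ ((Finset.univ.filter (fun r => i ∈ S r)).card : ℝ)) (hκ : κ₁ + κ₀ ≤ q)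
    (hcount : ((Finset.univ.filter
      (fun r => η / 2 ≤ |cross A z (S r) i (x r)|)).card : ℝ) < κ₀ * N) :
    ∃ zhat, testColumn C z (fun r => apply A (x r)) κ₀ κ₁ η = some zhat := by
  have hN' : (0 : ℝ) < N := by exact_mod_cast hN
  have hout : ∀ r, ¬ (η / 2 ≤ |cross A z (S r) i (x r)|) → i ∉ S r →
      |⟪z, apply A (x r)⟫_ℝ| ≤ C * η := by
    intro r hr hir
    rw [inner_apply_eq_add_cross A z i (hx0 r), hx0 r i hir, mul_zero, zero_add]
    nlinarith
  have hin : ∀ r, ¬ (η / 2 ≤ |cross A z (S r) i (x r)|) → i ∈ S r →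
      |⟪z, apply A (x r)⟫_ℝ| ∈ Set.Icc (1 - η) (C * (1 + η)) := by
    intro r hr hir
    rw [inner_apply_eq_add_cross A z i (hx0 r)]
    push Not at hr
    have h1 := abs_add_le (⟪z, column A i⟫_ℝ * x r i) (cross A z (S r) i (x r))
    have h2 := abs_sub_abs_le_abs_add (⟪z, column A i⟫_ℝ * x r i) (cross A z (S r) i (x r))
    have h3 : 1 ≤ |x r i| ∧ |x r i| ≤ C := by
      rcases hx r i hir with h | h
      · rw [abs_of_nonpos (by linarith [h.2])]
        constructor <;> linarith [h.1, h.2]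
      · rw [abs_of_nonneg (by linarith [h.1])]
        exact h
    rw [abs_mul] at h1 h2
    constructor
    · nlinarith [abs_nonneg (⟪z, column A i⟫_ℝ)]
    · nlinarith [abs_nonneg (⟪z, column A i⟫_ℝ)]
  have hbad : fracBad C z (fun r => apply A (x r)) η < κ₀ := by
    rw [fracBad, div_lt_iff₀ hN']
    refine lt_of_le_of_lt (Nat.cast_le.2 (Finset.card_le_card fun r hr => ?_)) hcount
    simp only [Finset.mem_filter, Finset.mem_univ, true_and] at hr ⊢
    by_contra hcon
    by_cases hir : i ∈ S r
    · exact hr (Or.inl (hin r hcon hir))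
    · exact hr (Or.inr ⟨abs_nonneg _, hout r hcon hir⟩)
  have hhigh : κ₁ ≤ fracHigh C z (fun r => apply A (x r)) η := by
    rw [fracHigh, le_div_iff₀ hN']
    have h1 : ((Finset.univ.filter (fun r => i ∈ S r)).card : ℝ) ≤
        ((Finset.univ.filter
          (fun r => |⟪z, apply A (x r)⟫_ℝ| ∈ Set.Icc (1 - η) (C * (1 + η)))).card : ℝ) +
        ((Finset.univ.filter
          (fun r => η / 2 ≤ |cross A z (S r) i (x r)|)).card : ℝ) := by
      rw [← Nat.cast_add]
      refine Nat.cast_le.2 ((Finset.card_le_card fun r hr => ?_).trans (Finset.card_union_le _ _))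
      simp only [Finset.mem_filter, Finset.mem_univ, true_and, Finset.mem_union] at hr ⊢
      by_cases hcon : η / 2 ≤ |cross A z (S r) i (x r)|
      · exact Or.inr hcon
      · exact Or.inl (hin r hcon hr)
    nlinarith
  exact ⟨_, by rw [testColumn, if_pos ⟨hbad, hhigh⟩]⟩

end Completeness

/-! ### Soundness far from the columns -/

section BadAndHigh

variable {n N m : ℕ}

/-- The coefficient vectors whose sample counts towards `fracHigh`. -/
def highSet (A : Matrix (Fin n) (Fin m) ℝ) (C : ℝ) (z : Vec n) (η : ℝ) : Set (Fin m → ℝ) :=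
  {x | |⟪z, apply A x⟫_ℝ| ∈ Set.Icc (1 - η) (C * (1 + η))}

/-- The coefficient vectors whose sample counts towards `fracBad`. -/
def badSet (A : Matrix (Fin n) (Fin m) ℝ) (C : ℝ) (z : Vec n) (η : ℝ) : Set (Fin m → ℝ) :=
  {x | |⟪z, apply A x⟫_ℝ| ∉ Set.Icc (1 - η) (C * (1 + η)) ∪ Set.Icc 0 (C * η)}

lemma measurableSet_highSet (A : Matrix (Fin n) (Fin m) ℝ) (C : ℝ) (z : Vec n) (η : ℝ) :
    MeasurableSet (highSet A C z η) :=
  (measurable_inner_apply A z).abs measurableSet_Icc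

lemma measurableSet_badSet (A : Matrix (Fin n) (Fin m) ℝ) (C : ℝ) (z : Vec n) (η : ℝ) :
    MeasurableSet (badSet A C z η) :=
  (measurable_inner_apply A z).abs (measurableSet_Icc.union measurableSet_Icc).compl

lemma mem_badSet_of_lt {A : Matrix (Fin n) (Fin m) ℝ} {C : ℝ} {z : Vec n} {η : ℝ}
    {x : Fin m → ℝ} (h1 : C * η < |⟪z, apply A x⟫_ℝ|) (h2 : |⟪z, apply A x⟫_ℝ| < 1 - η) :
    x ∈ badSet A C z η := by
  rintro (h | h)
  · exact absurd h.1 (not_le.2 h2)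
  · exact absurd h.2 (not_le.2 h1)

variable {Ω : Type*} [MeasurableSpace Ω] {P : Measure Ω} [IsProbabilityMeasure P]
  {A : Matrix (Fin n) (Fin m) ℝ} {C : ℝ}

/-- If no correlation exceeds `1 / (3 C)`, a high sample turns into its negative in steps too
short to jump over the forbidden gap, so high samples are not much likelier than bad ones. -/
lemma measureReal_highSet_le {X : Fin m → Ω → ℝ} (h : IsSymmFamily C P X) (hC : 1 ≤ C)
    {z : Vec n} {η : ℝ} (hη : 0 < η) (hη1 : (1 + C) * η < 1 / 3)
    (ha : ∀ j, |⟪z, column A j⟫_ℝ| < 1 / (3 * C)) :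
    P.real {ω | (fun j => X j ω) ∈ highSet A C z η} ≤
      (m + 1) * P.real {ω | (fun j => X j ω) ∈ badSet A C z η} := by
  refine h.measureReal_le_of_partialFlip Finset.univ (measurableSet_badSet A C z η) ?_
  intro y hy hyC
  have hy1 : 1 - η ≤ |∑ j, ⟪z, column A j⟫_ℝ * y j| := by
    rw [← inner_apply]; exact hy.1
  obtain ⟨t, ht, h1⟩ := exists_partialFlip_near Finset.univ (fun j => ⟪z, column A j⟫_ℝ) y
    (u := (1 - η + C * η) / 2) (θ := 1 / 3) (by norm_num) (fun j _ => by
      rw [abs_mul]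
      calc |⟪z, column A j⟫_ℝ| * |y j| ≤ 1 / (3 * C) * C :=
            mul_le_mul (ha j).le (hyC j) (abs_nonneg _) (by positivity)
        _ = 1 / 3 := by field_simp) (by nlinarith) (by nlinarith)
  refine ⟨t, ht, ?_⟩
  rw [← inner_apply, abs_le] at h1
  apply mem_badSet_of_lt <;> nlinarith

/-- If `A i` has a correlation with `z` that is neither small nor close to `1`, while the other
columns of the support have tiny ones, then the sample is bad with probability at least
`γ₀ / (m + 1)`: by sign flips, the cross term is tiny with probability at least `1 / (m + 1)`. -/
lemma le_measureReal_badSet {X : Fin m → Ω → ℝ} (h : IsSymmFamily C P X) (hC : 1 ≤ C)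
    {S : Finset (Fin m)} (hX : ∀ j, j ∉ S → ∀ ω, X j ω = 0)
    {z : Vec n} {η γ₀ : ℝ} (hη : 0 < η) (hη1 : 6 * C ^ 2 * η < 1) {i : Fin m}
    (hγ : γ₀ ≤ P.real {ω | X i ω ∈ Set.Icc 1 (1 + η)})
    (hi1 : 1 / (3 * C) ≤ |⟪z, column A i⟫_ℝ|) (hi2 : |⟪z, column A i⟫_ℝ| < 1 - 4 * η)
    (ha : ∀ j ∈ S.erase i, |⟪z, column A j⟫_ℝ| ≤ η / (2 * C)) :
    γ₀ ≤ (m + 1) * P.real {ω | (fun j => X j ω) ∈ badSet A C z η} := by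
  have h0 : {ω | X i ω ∈ Set.Icc 1 (1 + η)} =
      {ω | (fun j => X j ω) ∈ {y : Fin m → ℝ | y i ∈ Set.Icc 1 (1 + η) ∧
        ∀ j, j ∉ S → y j = 0}} := by
    ext ω
    exact ⟨fun h => ⟨h, fun j hj => hX j hj ω⟩, fun h => h.1⟩
  rw [h0] at hγ
  refine hγ.trans (h.measureReal_le_of_partialFlip (S.erase i)
    (measurableSet_badSet A C z η) ?_)
  rintro y ⟨hyi, hyS⟩ hyC
  obtain ⟨t, ht, h1⟩ := exists_partialFlip_near (S.erase i) (fun j => ⟪z, column A j⟫_ℝ) y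
    (u := 0) (θ := η / 2) (by positivity) (fun j hj => by
      rw [abs_mul]
      calc |⟪z, column A j⟫_ℝ| * |y j| ≤ η / (2 * C) * C :=
            mul_le_mul (ha j hj) (hyC j) (abs_nonneg _) (by positivity)
        _ = η / 2 := by field_simp) le_rfl (abs_nonneg _)
  refine ⟨t, ht, ?_⟩
  rw [sub_zero, abs_abs] at h1
  have h2 := inner_apply_eq_add_cross A z i (S := S) (x := partialFlip (S.erase i) t y)
    (fun j hj => by
      rw [partialFlip_of_notMem (fun h => hj (Finset.mem_of_mem_erase h)), hyS j hj])
  rw [partialFlip_of_notMem (Finset.notMem_erase i S)] at h2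
  change |cross A z S i (partialFlip (S.erase i) t y)| ≤ η / 2 at h1
  have h3 := abs_add_le (⟪z, column A i⟫_ℝ * y i) (cross A z S i (partialFlip (S.erase i) t y))
  have h4 := abs_sub_abs_le_abs_add (⟪z, column A i⟫_ℝ * y i)
    (cross A z S i (partialFlip (S.erase i) t y))
  rw [abs_mul, abs_of_nonneg (by linarith [hyi.1] : 0 ≤ y i)] at h3 h4
  rw [← h2] at h3 h4
  have h5 : 2 * C * η < 1 / (3 * C) := by
    rw [lt_div_iff₀ (by positivity)]
    nlinarith
  have h6 := abs_nonneg ⟪z, column A i⟫_ℝ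
  apply mem_badSet_of_lt
  · nlinarith [hyi.1]
  · nlinarith [hyi.1, hyi.2]

end BadAndHigh

section FarFromColumns

variable {n N m k : ℕ} {A : Matrix (Fin n) (Fin m) ℝ} {C : ℝ}
  {Ω : Type*} [MeasurableSpace Ω] {P : Measure Ω} [IsProbabilityMeasure P]
  {D : Measure ℝ} {S : Fin N → Finset (Fin m)} {x : Fin N → Fin m → Ω → ℝ} {δ : ℝ}

/-- If `z` is far from all columns and bad samples are rare, then so are high samples. -/
lemma sum_high_le_of_far (h : IsCoeffSample P D S x) (hD : IsSpikeSlab C D) (hC : 1 ≤ C)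
    {γ₀ η q β : ℝ} (hγ : γ₀ ≤ D.real (Set.Icc 1 (1 + η)))
    (hR : IsRIP k δ A) (hk : 2 ≤ k) (hδ0 : 0 ≤ δ) (hδ : 24 * C ^ 2 * δ ≤ η ^ 2)
    (hA : ∀ i, ‖column A i‖ = 1) (hη : 0 < η) (hη1 : 6 * C ^ 2 * η < 1)
    (hS : ∀ (i : Fin m) (T : Finset (Fin m)), i ∉ T → (T.card : ℝ) ≤ 8 * C ^ 2 / η ^ 2 →
          q * N ≤ ({r | i ∈ S r ∧ Disjoint (S r) T}.ncard : ℝ))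
    {z : Vec n} (hz : ‖z‖ = 1) (hfar : ∀ i, |⟪z, column A i⟫_ℝ| < 1 - 4 * η)
    (hβ : ∑ r, P.real {ω | (fun j => x r j ω) ∈ badSet A C z η} < β)
    (hβq : (m + 1) * β ≤ γ₀ * (q * N)) (hγ0 : 0 < γ₀) :
    ∑ r, P.real {ω | (fun j => x r j ω) ∈ highSet A C z η} ≤ (m + 1) * β := by
  classical
  have hC0 : 0 < C := by linarith
  have hC2 : 1 ≤ C ^ 2 := one_le_pow₀ hC
  have hη2 : η < 1 := by nlinarith
  have hδ1 : δ ≤ 1 := by nlinarith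
  have hsmall : ∀ i, |⟪z, column A i⟫_ℝ| < 1 / (3 * C) := by
    intro i
    by_contra hi
    push Not at hi
    set T := Finset.univ.filter
      (fun j => j ≠ i ∧ η / (2 * C) ≤ |⟪z, column A j⟫_ℝ|) with hT
    have hTcard : (T.card : ℝ) ≤ 8 * C ^ 2 / η ^ 2 := by
      have h1 := hR.card_le_of_le_abs_inner hk hδ0 hδ1 hA hz
        (θ := η / (2 * C)) (by positivity) (T := T) (fun j hj => (Finset.mem_filter.1 hj).2.2)
      have h2 : η ^ 2 / (8 * C ^ 2) ≤ (η / (2 * C)) ^ 2 - 3 * δ := by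
        rw [div_pow, mul_pow, div_le_iff₀ (by positivity)]
        field_simp
        nlinarith
      rw [← one_div_div, le_div_iff₀ (by positivity)]
      exact (mul_le_mul_of_nonneg_left h2 (Nat.cast_nonneg _)).trans h1
    have h1 := hS i T (by simp [hT]) hTcard
    set R := Finset.univ.filter (fun r => i ∈ S r ∧ Disjoint (S r) T) with hRdef
    have hR' : {r | i ∈ S r ∧ Disjoint (S r) T}.ncard = R.card := by
      rw [← Set.ncard_coe_finset]
      congr 1
      ext r
      simp [hRdef]
    rw [hR'] at h1
    have h2 : ∀ r ∈ R, γ₀ ≤ (m + 1) * P.real {ω | (fun j => x r j ω) ∈ badSet A C z η} := by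
      intro r hr
      obtain ⟨hir, hdis⟩ := (Finset.mem_filter.1 hr).2
      refine le_measureReal_badSet (h.isSymmFamily hD hC0.le r) hC (h.zero r) hη hη1 (i := i)
        ?_ hi (hfar i) ?_
      · refine hγ.trans (le_of_eq ?_)
        rw [← h.law r i hir, Measure.real,
          Measure.map_apply (h.measurable r i) measurableSet_Icc]
        rfl
      · intro j hj
        by_contra hcon
        push Not at hcon
        obtain ⟨hji, hjS⟩ := Finset.mem_erase.1 hj
        exact Finset.disjoint_left.1 hdis hjS (by simp [hT, hji, hcon.le])
    have h3 := Finset.card_nsmul_le_sum R _ _ h2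
    rw [nsmul_eq_mul, ← Finset.mul_sum] at h3
    have h4 : ∑ r ∈ R, P.real {ω | (fun j => x r j ω) ∈ badSet A C z η} ≤
        ∑ r, P.real {ω | (fun j => x r j ω) ∈ badSet A C z η} :=
      Finset.sum_le_sum_of_subset_of_nonneg (Finset.subset_univ _)
        fun _ _ _ => measureReal_nonneg
    have h5 : (0 : ℝ) < m + 1 := by positivity
    nlinarith
  have h1 : (1 + C) * η < 1 / 3 := by nlinarith
  calc ∑ r, P.real {ω | (fun j => x r j ω) ∈ highSet A C z η}
      ≤ ∑ r, (m + 1) * P.real {ω | (fun j => x r j ω) ∈ badSet A C z η} :=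
        Finset.sum_le_sum fun r _ =>
          measureReal_highSet_le (h.isSymmFamily hD hC0.le r) hC hη h1 hsmall
    _ = (m + 1) * ∑ r, P.real {ω | (fun j => x r j ω) ∈ badSet A C z η} := by
        rw [Finset.mul_sum]
    _ ≤ (m + 1) * β := by gcongr

/-- If `z` is far from all columns, TestColumn answers NO except with small probability. -/
lemma measureReal_testColumn_far (h : IsCoeffSample P D S x) (hD : IsSpikeSlab C D) (hC : 1 ≤ C)
    {γ₀ η q κ₀ κ₁ : ℝ} (hγ : γ₀ ≤ D.real (Set.Icc 1 (1 + η)))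
    (hR : IsRIP k δ A) (hk : 2 ≤ k) (hδ0 : 0 ≤ δ) (hδ : 24 * C ^ 2 * δ ≤ η ^ 2)
    (hA : ∀ i, ‖column A i‖ = 1) (hη : 0 < η) (hη1 : 6 * C ^ 2 * η < 1)
    (hS : ∀ (i : Fin m) (T : Finset (Fin m)), i ∉ T → (T.card : ℝ) ≤ 8 * C ^ 2 / η ^ 2 →
          q * N ≤ ({r | i ∈ S r ∧ Disjoint (S r) T}.ncard : ℝ))
    {z : Vec n} (hz : ‖z‖ = 1) (hfar : ∀ i, |⟪z, column A i⟫_ℝ| < 1 - 4 * η)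
    (hγ0 : 0 < γ₀) (hN : 0 < N) (hκ₀ : 0 < κ₀) (hκq : (m + 1) * (2 * κ₀) ≤ γ₀ * q)
    (hκ₁ : 2 * ((m + 1) * (2 * κ₀)) ≤ κ₁) :
    P.real {ω | ∃ zhat, testColumn C z (fun r => apply A (fun i => x r i ω)) κ₀ κ₁ η =
      some zhat} ≤ Real.exp (-(κ₀ * N) / 8) := by
  classical
  have hN' : (0 : ℝ) < N := by exact_mod_cast hN
  have hyes : ∀ ω, (∃ zhat, testColumn C z (fun r => apply A (fun i => x r i ω)) κ₀ κ₁ η =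
      some zhat) → fracBad C z (fun r => apply A (fun i => x r i ω)) η < κ₀ ∧
        κ₁ ≤ fracHigh C z (fun r => apply A (fun i => x r i ω)) η := by
    rintro ω ⟨zhat, hω⟩
    by_contra hcon
    rw [testColumn, if_neg hcon] at hω
    exact absurd hω (by simp)
  have hm : ∀ r, Measurable (fun ω j => x r j ω) := fun r =>
    measurable_pi_lambda _ (h.measurable r)
  by_cases hβ : ∑ r, P.real {ω | (fun j => x r j ω) ∈ badSet A C z η} < 2 * κ₀ * N
  · have h1 := sum_high_le_of_far h hD hC hγ hR hk hδ0 hδ hA hη hη1 hS hz hfar hβ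
      (by nlinarith) hγ0
    refine (measureReal_mono (fun ω hω => ?_) (measure_ne_top _ _)).trans
      ((count_ge_le hm h.iIndepFun_vectors (B := fun _ => highSet A C z η)
        (fun _ => measurableSet_highSet A C z η) (T := κ₁ * N) ?_).trans ?_)
    · have h2 := (hyes ω hω).2
      rw [fracHigh, le_div_iff₀ hN'] at h2
      refine h2.trans (Nat.cast_le.2 (Finset.card_le_card fun r hr => ?_))
      rw [Finset.mem_filter] at hr ⊢
      exact hr
    · refine h1.trans ?_
      nlinarith
    · refine Real.exp_le_exp.2 ?_
      have h2 : κ₀ ≤ κ₁ := by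
        have : (0 : ℝ) ≤ m := Nat.cast_nonneg _
        nlinarith
      have h3 : κ₀ * N ≤ κ₁ * N := by gcongr
      linarith
  · push Not at hβ
    refine (measureReal_mono (fun ω hω => ?_) (measure_ne_top _ _)).trans
      ((count_le_le hm h.iIndepFun_vectors (B := fun _ => badSet A C z η)
        (fun _ => measurableSet_badSet A C z η) (T := 2 * κ₀ * N) (by positivity) hβ).trans ?_)
    · have h2 := (hyes ω hω).1
      rw [fracBad, div_lt_iff₀ hN'] at h2
      have h3 : 2 * κ₀ * N / 2 = κ₀ * N := by ring
      rw [Set.mem_ofPred_eq, h3]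
      refine (Nat.cast_le.2 (Finset.card_le_card fun r hr => ?_)).trans h2.le
      rw [Finset.mem_filter] at hr ⊢
      exact hr
    · refine Real.exp_le_exp.2 ?_
      have : 0 < κ₀ * N := by positivity
      linarith

end FarFromColumns

/-! ### The normalized mean near a column -/

section NearColumn

variable {n N m k : ℕ} {A : Matrix (Fin n) (Fin m) ℝ} {C : ℝ}

/-- The cross term of a sample in direction `z`, kept only if the coefficient of `A i` has the
sign of `b`. -/
noncomputable def signedCross (A : Matrix (Fin n) (Fin m) ℝ) (z : Vec n) (S : Finset (Fin m))
    (i : Fin m) (b : ℝ) (x : Fin m → ℝ) : ℝ :=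
  {y : Fin m → ℝ | 0 < b * y i}.indicator (cross A z S i) x

lemma measurableSet_pos_coord (b : ℝ) (i : Fin m) :
    MeasurableSet {y : Fin m → ℝ | 0 < b * y i} :=
  measurableSet_lt measurable_const (by fun_prop)

lemma measurable_signedCross (A : Matrix (Fin n) (Fin m) ℝ) (z : Vec n) (S : Finset (Fin m))
    (i : Fin m) (b : ℝ) : Measurable (signedCross A z S i b) :=
  (measurable_cross A z S i).indicator (measurableSet_pos_coord b i)

lemma abs_signedCross_le (hA : ∀ i, ‖column A i‖ = 1) {z : Vec n} (hz : ‖z‖ = 1)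
    {S : Finset (Fin m)} (hS : S.card ≤ k) (hC : 0 ≤ C) (i : Fin m) (b : ℝ) {x : Fin m → ℝ}
    (hx : ∀ j, |x j| ≤ C) : |signedCross A z S i b x| ≤ k * C := by
  have h1 : |cross A z S i x| ≤ k * C := by
    rw [cross]
    refine (Finset.abs_sum_le_sum_abs _ _).trans
      ((Finset.sum_le_card_nsmul _ _ C fun j _ => ?_).trans ?_)
    · rw [abs_mul]
      have h2 : |⟪z, column A j⟫_ℝ| ≤ 1 := by
        have := abs_real_inner_le_norm z (column A j)
        rwa [hz, hA, mul_one] at this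
      nlinarith [hx j, abs_nonneg (x j)]
    · rw [nsmul_eq_mul]
      gcongr
      exact (Finset.card_le_card (Finset.erase_subset _ _)).trans hS
  rw [signedCross]
  by_cases h : 0 < b * x i
  · rwa [Set.indicator_of_mem (by exact h)]
  · rw [Set.indicator_of_notMem (by exact h), abs_zero]
    positivity

section Probability

variable {Ω : Type*} [MeasurableSpace Ω] {P : Measure Ω} [IsProbabilityMeasure P]

/-- Changing the signs of all coordinates but `i` preserves the law and negates `signedCross`. -/
lemma integral_signedCross {X : Fin m → Ω → ℝ} (h : IsSymmFamily C P X) (z : Vec n)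
    (S : Finset (Fin m)) (i : Fin m) (b : ℝ) :
    ∫ ω, signedCross A z S i b (fun j => X j ω) ∂P = 0 := by
  have hm := h.measurable
  have hg := measurable_signedCross A z S i b
  refine integral_eq_zero_of_map_neg (by fun_prop) ?_
  set s : Fin m → ℝ := fun j => if j = i then 1 else -1 with hs
  have h1 := map_signs_eq h.measurable h.indep h.symm (s := s)
    (fun j => by simp only [hs]; split_ifs <;> simp)
  have h2 : (fun ω => -signedCross A z S i b (fun j => X j ω)) =
      signedCross A z S i b ∘ (fun ω j => s j * X j ω) := by
    ext ω
    have hi : s i * X i ω = X i ω := by simp [hs]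
    have hc : cross A z S i (fun j => s j * X j ω) = -cross A z S i (fun j => X j ω) := by
      rw [cross, cross, ← Finset.sum_neg_distrib]
      refine Finset.sum_congr rfl fun j hj => ?_
      simp [hs, Finset.ne_of_mem_erase hj]
    rw [Function.comp_apply, signedCross, signedCross]
    by_cases h : 0 < b * X i ω
    · rw [Set.indicator_of_mem (by exact h), Set.indicator_of_mem
        (by change 0 < b * (s i * X i ω); rwa [hi]), hc]
    · rw [Set.indicator_of_notMem (by exact h), Set.indicator_of_notMem
        (by change ¬ 0 < b * (s i * X i ω); rwa [hi]), neg_zero]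
  rw [h2, ← Measure.map_map hg (by fun_prop), h1, Measure.map_map hg (by fun_prop)]
  rfl

variable {D : Measure ℝ} {S : Fin N → Finset (Fin m)} {x : Fin N → Fin m → Ω → ℝ}

open Classical in
/-- Only the samples with `i ∈ S r` contribute to the sum, so the variance proxy counts only
these. -/
lemma signedCross_sum_le (h : IsCoeffSample P D S x) (hD : IsSpikeSlab C D) (hC : 0 ≤ C)
    (hA : ∀ i, ‖column A i‖ = 1) (hS : ∀ r, (S r).card ≤ k) {z : Vec n} (hz : ‖z‖ = 1)
    (i : Fin m) (b : ℝ) {t : ℝ} (ht : 0 ≤ t) :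
    P.real {ω | t ≤ |∑ r, signedCross A z (S r) i b (fun j => x r j ω)|} ≤
      2 * Real.exp (-(t ^ 2 / (2 * ((Finset.univ.filter (fun r => i ∈ S r)).card *
        (k * C) ^ 2)))) := by
  set R := Finset.univ.filter (fun r => i ∈ S r) with hR
  have h1 : ∀ ω, ∑ r, signedCross A z (S r) i b (fun j => x r j ω) =
      ∑ r ∈ R, signedCross A z (S r) i b (fun j => x r j ω) := by
    intro ω
    refine (Finset.sum_subset (Finset.subset_univ _) fun r _ hr => ?_).symm
    have hir : i ∉ S r := fun hi => hr (by simp [hR, hi])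
    rw [signedCross, Set.indicator_of_notMem]
    change ¬ 0 < b * x r i ω
    simp [h.zero r i hir]
  simp_rw [h1]
  refine hoeffding_two_sided (c := fun _ => k * C)
    (h.iIndepFun_vectors.comp (fun r => signedCross A z (S r) i b)
      fun r => measurable_signedCross A z (S r) i b)
    (fun r => (measurable_signedCross A z (S r) i b).comp
      (measurable_pi_lambda _ (h.measurable r))) (fun r _ => ?_)
    (fun r _ => integral_signedCross (h.isSymmFamily hD hC r) z (S r) i b) ?_ ht
  · filter_upwards [ae_all_iff.2 (h.isSymmFamily hD hC r).bound] with ω hω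
    exact abs_signedCross_le hA hz (hS r) hC i b hω
  · simp

open Classical in
/-- About half of the samples whose support contains `i` have `b * x i > 0`. -/
lemma count_pos_le (h : IsCoeffSample P D S x) (hD : IsSpikeSlab C D) (hC : 0 ≤ C) (i : Fin m)
    {b : ℝ} (hb : b = -1 ∨ b = 1) :
    P.real {ω | ((Finset.univ.filter (fun r => 0 < b * x r i ω)).card : ℝ) ≤
        (Finset.univ.filter (fun r => i ∈ S r)).card / 4} ≤
      Real.exp (-((Finset.univ.filter (fun r => i ∈ S r)).card / 16)) := by
  have h1 := count_le_le (fun r => measurable_pi_lambda _ (h.measurable r))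
    h.iIndepFun_vectors (B := fun _ => {y | 0 < b * y i})
    (fun _ => measurableSet_pos_coord b i)
    (T := (Finset.univ.filter (fun r => i ∈ S r)).card / 2) (by positivity) (by
      refine le_trans ?_ (Finset.sum_le_sum_of_subset_of_nonneg
        (Finset.subset_univ (Finset.univ.filter (fun r => i ∈ S r)))
        fun _ _ _ => measureReal_nonneg)
      refine le_trans (le_of_eq ?_) (Finset.card_nsmul_le_sum _ _ (1 / 2) fun r hr =>
        h.half_le_measureReal_pos hD hC (Finset.mem_filter.1 hr).2 hb)
      rw [nsmul_eq_mul]; ring)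
  convert h1 using 2
  · ext ω
    simp only [Set.mem_ofPred_eq]
    rw [div_div]
    norm_num
  · ring

end Probability

open Classical in
/-- Away from the few samples with a large cross term, exactly the samples with `b * x i > 0` are
selected; these add up to a multiple of `b A i` plus an error, which is small compared to it. -/
lemma norm_normalized_mean_sub_le (hA : ∀ i, ‖column A i‖ = 1) {η₀ : ℝ} (hη₀ : η₀ < 1)
    {z : Vec n} {i : Fin m} {b : ℝ} (hb : b = -1 ∨ b = 1)
    (hz : 3 / 4 ≤ b * ⟪z, column A i⟫_ℝ) {S : Fin N → Finset (Fin m)}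
    (hS : ∀ r, (S r).card ≤ k) {x : Fin N → Fin m → ℝ} (hx0 : ∀ r j, j ∉ S r → x r j = 0)
    (hxC : ∀ r j, |x r j| ≤ C) (hx1 : ∀ r, ∀ j ∈ S r, 1 ≤ |x r j|) {M : ℝ} (hM : 0 < M)
    (hpos : M / 4 < ((Finset.univ.filter (fun r => 0 < b * x r i)).card : ℝ))
    (hcross : ((Finset.univ.filter
      (fun r => 1 / 4 ≤ |cross A z (S r) i (x r)|)).card : ℝ) * (k * C) ≤ η₀ * M / 16)
    (hmean : ∀ l : Fin n, √n * |∑ r, signedCross A (EuclideanSpace.single l 1) (S r) i b (x r)| ≤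
      η₀ * M / 16) (hn : 0 < n) :
    ‖‖selectedMean z (fun r => apply A (x r))‖⁻¹ • selectedMean z (fun r => apply A (x r)) -
      b • column A i‖ ≤ η₀ := by
  set y : Fin N → Vec n := fun r => apply A (x r) with hy
  set G := Finset.univ.filter (fun r => 0 < b * x r i) with hG
  set E := Finset.univ.filter (fun r => 1 / 4 ≤ |cross A z (S r) i (x r)|) with hE
  set e := b • column A i with he
  have hb2 : b * b = 1 := by rcases hb with rfl | rfl <;> norm_num
  have hbabs : |b| = 1 := by rcases hb with rfl | rfl <;> norm_num
  have he1 : ‖e‖ = 1 := by rw [he, norm_smul, hA, mul_one, Real.norm_eq_abs, hbabs]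
  have hmemG : ∀ r ∈ G, i ∈ S r := by
    intro r hr
    by_contra hir
    have := (Finset.mem_filter.1 hr).2
    rw [hx0 r i hir, mul_zero] at this
    exact lt_irrefl _ this
  have hbx : ∀ r, i ∈ S r → 1 ≤ |b * x r i| := fun r hr => by
    rw [abs_mul, hbabs, one_mul]; exact hx1 r i hr
  -- away from `E` the selected samples are those in `G`
  have hsel : ∀ r, r ∉ E → (r ∈ selected z y ↔ r ∈ G) := by
    intro r hr
    have hc : |cross A z (S r) i (x r)| < 1 / 4 := by
      by_contra hcon
      exact hr (by simpa [hE] using hcon)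
    obtain ⟨hc1, hc2⟩ := abs_lt.1 hc
    have h1 : ⟪y r, z⟫_ℝ = (b * ⟪z, column A i⟫_ℝ) * (b * x r i) +
        cross A z (S r) i (x r) := by
      rw [real_inner_comm, hy, inner_apply_eq_add_cross A z i (hx0 r)]
      linear_combination (-⟪z, column A i⟫_ℝ * x r i) * hb2
    simp only [selected, Finset.mem_filter, Finset.mem_univ, true_and, h1, hG]
    constructor
    · intro h2
      by_contra hcon
      push Not at hcon
      nlinarith
    · intro h2
      have h3 := hbx r (hmemG r (by simpa [hG] using h2))
      rw [abs_of_pos h2] at h3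
      nlinarith
  -- decomposition of the sum of the selected samples
  set α := ∑ r ∈ G, b * x r i with hα
  set U := ∑ r ∈ G, (y r - x r i • column A i) with hU
  set V := ∑ r ∈ selected z y \ G, y r - ∑ r ∈ G \ selected z y, y r with hV
  have hsum : ∑ r ∈ selected z y, y r = α • e + (U + V) := by
    have h1 : ∑ r ∈ G, y r = α • e + U := by
      rw [hα, hU, Finset.sum_sub_distrib, Finset.sum_smul, he]
      have : ∀ r ∈ G, (b * x r i) • b • column A i = x r i • column A i := by
        intro r _
        rw [smul_smul]
        congr 1
        linear_combination x r i * hb2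
      rw [Finset.sum_congr rfl this]
      abel
    have h2 := Finset.sum_sdiff_sub_sum_sdiff (s₁ := G) (s₂ := selected z y) (f := y)
    rw [hV, ← add_assoc, ← h1]
    rw [h2]
    abel
  have hynorm : ∀ r, ‖y r‖ ≤ k * C := by
    intro r
    refine (norm_apply_le_of_support hA (hxC r) (hx0 r)).trans ?_
    have h0 : 0 ≤ C := (abs_nonneg _).trans (hxC r i)
    gcongr
    exact hS r
  have hVnorm : ‖V‖ ≤ η₀ * M / 16 := by
    refine le_trans ?_ hcross
    have h1 : ∀ s : Finset (Fin N), ‖∑ r ∈ s, y r‖ ≤ s.card * (k * C) := fun s => by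
      refine (norm_sum_le _ _).trans ((Finset.sum_le_card_nsmul _ _ _ fun r _ =>
        hynorm r).trans ?_)
      rw [nsmul_eq_mul]
    have h2 : ((selected z y \ G).card : ℝ) + (G \ selected z y).card ≤ E.card := by
      rw [← Nat.cast_add, ← Finset.card_union_of_disjoint disjoint_sdiff_sdiff]
      refine Nat.cast_le.2 (Finset.card_le_card fun r hr => ?_)
      by_contra hcon
      have := hsel r hcon
      simp only [Finset.mem_union, Finset.mem_sdiff] at hr
      tauto
    have hkC : 0 ≤ (k : ℝ) * C := by
      have hN : Nonempty (Fin N) := by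
        by_contra hcon
        rw [not_nonempty_iff] at hcon
        have : G.card = 0 := by rw [Finset.card_eq_zero]; exact Finset.eq_empty_of_isEmpty _
        rw [this] at hpos
        norm_num at hpos
        linarith
      exact (norm_nonneg _).trans (hynorm hN.some)
    calc ‖V‖ ≤ _ := norm_sub_le _ _
      _ ≤ (selected z y \ G).card * (k * C) + (G \ selected z y).card * (k * C) :=
        add_le_add (h1 _) (h1 _)
      _ = ((selected z y \ G).card + (G \ selected z y).card) * (k * C) := by ring
      _ ≤ E.card * (k * C) := by gcongr
  have hUnorm : ‖U‖ ≤ η₀ * M / 16 := by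
    have hn' : (0 : ℝ) < n := by exact_mod_cast hn
    have hsq : 0 < √(n : ℝ) := Real.sqrt_pos.2 hn'
    have hcoord : ∀ l, U l =
        ∑ r, signedCross A (EuclideanSpace.single l 1) (S r) i b (x r) := by
      intro l
      have h1 : ∀ v : Vec n, v l = ⟪(EuclideanSpace.single l 1 : Vec n), v⟫_ℝ := by
        intro v
        simp [EuclideanSpace.inner_single_left]
      rw [h1, hU, inner_sum, hG, Finset.sum_filter]
      refine Finset.sum_congr rfl fun r _ => ?_
      rw [signedCross, Set.indicator_apply]
      simp only [Set.mem_ofPred_eq]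
      split_ifs
      · rw [inner_sub_right, real_inner_smul_right, hy,
          inner_apply_eq_add_cross A _ i (hx0 r)]
        ring
      · rfl
    have hB : 0 ≤ η₀ * M / 16 := le_trans (by positivity) (hmean ⟨0, hn⟩)
    have h1 : ‖U‖ ^ 2 ≤ (η₀ * M / 16) ^ 2 := by
      rw [EuclideanSpace.norm_sq_eq]
      refine (Finset.sum_le_card_nsmul _ _ ((η₀ * M / 16) ^ 2 / n) fun l _ => ?_).trans ?_
      · rw [le_div_iff₀ hn', Real.norm_eq_abs, hcoord]
        calc _ = (√n * |∑ r, signedCross A (EuclideanSpace.single l 1) (S r) i b (x r)|) ^ 2 := by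
              rw [mul_pow, Real.sq_sqrt hn'.le, mul_comm]
          _ ≤ _ := pow_le_pow_left₀ (by positivity) (hmean l) 2
      · rw [Finset.card_univ, Fintype.card_fin, nsmul_eq_mul, mul_div_cancel₀ _ hn'.ne']
    exact (pow_le_pow_iff_left₀ (norm_nonneg _) hB two_ne_zero).1 h1
  have hαM : M / 4 < α := by
    refine hpos.trans_le ?_
    have : (G.card : ℝ) = G.card • (1 : ℝ) := by simp
    rw [this]
    refine Finset.card_nsmul_le_sum _ _ _ fun r hr => ?_
    have h1 := hbx r (hmemG r hr)
    rwa [abs_of_pos (Finset.mem_filter.1 hr).2] at h1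
  have hα0 : 0 < α := by linarith
  have huv : ‖U + V‖ ≤ η₀ * M / 8 := (norm_add_le _ _).trans (by linarith)
  have hη₀' : 0 ≤ η₀ := by
    have : 0 ≤ η₀ * M := by linarith [norm_nonneg (U + V)]
    exact nonneg_of_mul_nonneg_left this hM
  have huα : ‖U + V‖ < α := by nlinarith
  have hres : ‖‖α • e + (U + V)‖⁻¹ • (α • e + (U + V)) - e‖ ≤ η₀ := by
    refine (norm_normalize_sub_le he1 hα0 huα).trans ?_
    rw [div_le_iff₀ hα0]
    nlinarith
  -- the number of selected samples cancels in the normalization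
  have hcard : (0 : ℝ) < (selected z y).card := by
    rw [Nat.cast_pos, Finset.card_pos]
    by_contra hcon
    rw [Finset.not_nonempty_iff_eq_empty] at hcon
    rw [hcon, Finset.sum_empty] at hsum
    have h1 : ‖α • e‖ = ‖U + V‖ := by
      rw [eq_neg_of_add_eq_zero_left hsum.symm, norm_neg]
    rw [norm_smul, he1, mul_one, Real.norm_of_nonneg hα0.le] at h1
    linarith
  rw [selectedMean, norm_smul, norm_inv, Real.norm_of_nonneg hcard.le, smul_smul, mul_inv, inv_inv,
    mul_right_comm, mul_inv_cancel₀ hcard.ne', one_mul, hsum]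
  exact hres

end NearColumn

section Main

variable {n N m k : ℕ} {A : Matrix (Fin n) (Fin m) ℝ} {C : ℝ}
  {Ω : Type*} [MeasurableSpace Ω] {P : Measure Ω} [IsProbabilityMeasure P]
  {D : Measure ℝ} {S : Fin N → Finset (Fin m)} {x : Fin N → Fin m → Ω → ℝ} {δ : ℝ}

open Classical in
/-- If `z` is close to `b A i`, then so is, much more precisely, the normalized mean of the selected
samples, except with small probability. -/
lemma measureReal_mean_near (h : IsCoeffSample P D S x) (hD : IsSpikeSlab C D) (hC : 1 ≤ C)
    (hS : ∀ r, (S r).card ≤ k) (hR : IsRIP k δ A) (hk : 2 ≤ k) (hδ0 : 0 ≤ δ)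
    (hA : ∀ i, ‖column A i‖ = 1) {η η₀ q : ℝ} (hη : 0 < η) (hη1 : η ≤ 1 / 16) (hδ : 6 * δ ≤ η)
    (hη₀ : 0 < η₀) (hη₀1 : η₀ < 1) (hn : 0 < n) {z : Vec n} (hz : ‖z‖ = 1) {i : Fin m} {b : ℝ}
    (hb : b = -1 ∨ b = 1) (hzi : ‖z - b • column A i‖ ^ 2 ≤ 8 * η) (hq : 0 < q) (hN : 0 < N)
    (hM : q * N ≤ ((Finset.univ.filter (fun r => i ∈ S r)).card : ℝ))
    (hexp : 2 * Real.exp (-(1 / (800 * C ^ 2 * η))) ≤ η₀ * q / (32 * (k * C))) :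
    P.real {ω | ¬ ‖‖selectedMean z (fun r => apply A (fun i => x r i ω))‖⁻¹ •
        selectedMean z (fun r => apply A (fun i => x r i ω)) - b • column A i‖ ≤ η₀} ≤
      Real.exp (-(q * N / 16)) + n * (2 * Real.exp (-(η₀ ^ 2 * (q * N) /
        (512 * n * (k * C) ^ 2)))) + Real.exp (-(η₀ * (q * N) / (128 * (k * C)))) := by
  set M : ℝ := ((Finset.univ.filter (fun r => i ∈ S r)).card : ℝ) with hMdef
  have hC0 : 0 < C := by linarith
  have hN' : (0 : ℝ) < N := by exact_mod_cast hN
  have hn' : (0 : ℝ) < n := by exact_mod_cast hn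
  have hk' : (0 : ℝ) < k := by exact_mod_cast (by omega : 0 < k)
  have hqN : 0 < q * N := by positivity
  have hM0 : 0 < M := hqN.trans_le hM
  have hkC : 0 < k * C := by positivity
  have hsn : 0 < √(n : ℝ) := Real.sqrt_pos.2 hn'
  have hbi : 3 / 4 ≤ b * ⟪z, column A i⟫_ℝ := by
    rw [norm_sub_smul_column_sq hA hz i hb] at hzi
    linarith
  -- the three exceptional events
  have hE1 := count_pos_le h hD hC0.le i hb
  have hE2 : ∀ l : Fin n, P.real {ω | η₀ * M / (16 * √n) ≤
      |∑ r, signedCross A (EuclideanSpace.single l 1) (S r) i b (fun j => x r j ω)|} ≤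
      2 * Real.exp (-(η₀ ^ 2 * (q * N) / (512 * n * (k * C) ^ 2))) := by
    intro l
    refine (signedCross_sum_le h hD hC0.le hA hS (z := EuclideanSpace.single l 1) (by simp) i b
      (by positivity)).trans ?_
    refine mul_le_mul_of_nonneg_left (Real.exp_le_exp.2 (neg_le_neg ?_)) zero_le_two
    rw [← hMdef, div_pow, mul_pow _ M, mul_pow _ √(n : ℝ), Real.sq_sqrt hn'.le]
    calc η₀ ^ 2 * (q * N) / (512 * n * (k * C) ^ 2)
        ≤ η₀ ^ 2 * M / (512 * n * (k * C) ^ 2) := by gcongr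
      _ = _ := by field_simp; ring
  have hE3 : P.real {ω | η₀ * M / (16 * (k * C)) ≤ ((Finset.univ.filter
      (fun r => 1 / 4 ≤ |cross A z (S r) i (fun j => x r j ω)|)).card : ℝ)} ≤
      Real.exp (-(η₀ * (q * N) / (128 * (k * C)))) := by
    refine (cross_count_le h hD hC0 hS hR hk hδ0 (by linarith) hA hb hzi
      (σ := 25 * η) (by norm_num) (by linarith) ?_).trans (Real.exp_le_exp.2 ?_)
    · have h1 : (1 / 4 : ℝ) ^ 2 / (2 * (C ^ 2 * (25 * η))) = 1 / (800 * C ^ 2 * η) := by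
        field_simp; norm_num
      rw [h1]
      calc (N : ℝ) * (2 * Real.exp (-(1 / (800 * C ^ 2 * η))))
          ≤ N * (η₀ * q / (32 * (k * C))) := by gcongr
        _ = η₀ * (q * N) / (16 * (k * C)) / 2 := by field_simp; norm_num
        _ ≤ _ := by gcongr
    · rw [neg_div, neg_le_neg_iff, div_div]
      rw [show (16 * (k * C) * 8 : ℝ) = 128 * (k * C) by ring]
      gcongr
  have hsub : P.real {ω | ¬ ‖‖selectedMean z (fun r => apply A (fun i => x r i ω))‖⁻¹ •
        selectedMean z (fun r => apply A (fun i => x r i ω)) - b • column A i‖ ≤ η₀} ≤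
      P.real (({ω | ((Finset.univ.filter (fun r => 0 < b * x r i ω)).card : ℝ) ≤ M / 4} ∪
        ⋃ l ∈ (Finset.univ : Finset (Fin n)), {ω | η₀ * M / (16 * √n) ≤
          |∑ r, signedCross A (EuclideanSpace.single l 1) (S r) i b (fun j => x r j ω)|}) ∪
        {ω | η₀ * M / (16 * (k * C)) ≤ ((Finset.univ.filter
          (fun r => 1 / 4 ≤ |cross A z (S r) i (fun j => x r j ω)|)).card : ℝ)}) := by
    refine ENNReal.toReal_mono (measure_ne_top _ _) (measure_mono_ae ?_)
    filter_upwards [h.ae_mem hD, ae_all_iff.2 fun r =>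
      ae_all_iff.2 (h.isSymmFamily hD hC0.le r).bound] with ω hω1 hω2 hω
    by_contra hcon
    have h1 := fun h' => hcon (Or.inl (Or.inl h'))
    have h2 := fun l h' => hcon (Or.inl (Or.inr (Set.mem_biUnion (Finset.mem_univ l) h')))
    have h3 := fun h' => hcon (Or.inr h')
    simp only [Set.mem_ofPred_eq, imp_false, not_le] at h1 h2 h3
    refine hω (norm_normalized_mean_sub_le hA hη₀1 hb hbi hS (fun r j hj => h.zero r j hj ω)
      hω2 (fun r j hj => ?_) hM0 h1 ?_ (fun l => ?_) hn)
    · rcases hω1 r j hj with h4 | h4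
      · rw [abs_of_nonpos (by linarith [h4.2])]; linarith [h4.2]
      · rw [abs_of_nonneg (by linarith [h4.1])]; exact h4.1
    · have h4 := h3.le
      rw [le_div_iff₀ (by positivity)] at h4
      rw [le_div_iff₀ (by norm_num)]
      linarith
    · have h4 := (h2 l).le
      rw [le_div_iff₀ (by positivity)] at h4
      rw [le_div_iff₀ (by norm_num)]
      linarith
  refine hsub.trans ((measureReal_union_le _ _).trans (add_le_add ((measureReal_union_le _ _).trans
    (add_le_add (hE1.trans ?_) ?_)) hE3))
  · refine Real.exp_le_exp.2 ?_
    have : q * N / 16 ≤ M / 16 := by gcongr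
    linarith
  · refine (measureReal_biUnion_finset_le _ _).trans
      ((Finset.sum_le_card_nsmul _ _ _ fun l _ => hE2 l).trans ?_)
    simp

end Main

/-! ### Numerical consequences of the parameter choice -/

section Parameters

lemma exp_neg_le_of_log {γ X : ℝ} (hγ : 0 < γ) (hγ2 : γ ≤ 1 / 2)
    (hX : 4 * Real.log (1 / γ) ≤ X) : Real.exp (-X) ≤ γ / 8 := by
  have h1 : Real.exp (-(4 * Real.log (1 / γ))) = γ ^ 4 := by
    rw [one_div, Real.log_inv, show -(4 * -Real.log γ) = (4 : ℕ) * Real.log γ by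
      push_cast; ring, Real.exp_nat_mul, Real.exp_log hγ]
  have h2 : γ ^ 4 ≤ γ / 8 := by
    have h3 : γ ^ 3 ≤ (1 / 2) ^ 3 := pow_le_pow_left₀ hγ.le hγ2 3
    have h4 : γ ^ 4 = γ ^ 3 * γ := by ring
    nlinarith
  calc Real.exp (-X) ≤ Real.exp (-(4 * Real.log (1 / γ))) := Real.exp_le_exp.2 (neg_le_neg hX)
    _ ≤ _ := by rw [h1]; exact h2

/-- The upper bound on `η` makes the sub-Gaussian tail of the cross terms polynomially small. -/
lemma exp_neg_inv_le {C m n k η q η₀ : ℝ} (hC : 1 ≤ C) (hm : 1 ≤ m) (hn : 1 ≤ n) (hk : 1 ≤ k)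
    (hη : 0 < η) (hq : 0 < q) (hq1 : q ≤ 1) (hη₀ : 0 < η₀) (hη₀1 : η₀ ≤ 1)
    (hmk : 1000 * C ^ 2 * k ≤ m) (hΛ1 : 1 ≤ Real.log (m * n / (q * η₀)))
    (hΛη : 10000 * C ^ 2 * η * Real.log (m * n / (q * η₀)) ^ 2 < 1) :
    2 * Real.exp (-(1 / (800 * C ^ 2 * η))) ≤ η₀ * q / (32 * (k * C)) := by
  have hm0 : 0 < m := by linarith
  have hn0 : 0 < n := by linarith
  have hqη₀ : q * η₀ ≤ 1 := mul_le_one₀ hq1 hη₀.le hη₀1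
  have hqη₀0 : 0 < q * η₀ := mul_pos hq hη₀
  have hargpos : 0 < m * n / (q * η₀) := by positivity
  set Λ := Real.log (m * n / (q * η₀)) with hΛ
  have h1 : 2 * Λ ≤ 1 / (800 * C ^ 2 * η) := by
    rw [le_div_iff₀ (by positivity)]
    have h0 : 0 < C ^ 2 * η := by positivity
    have h1 : Λ ≤ Λ ^ 2 := le_self_pow₀ hΛ1 two_ne_zero
    have h2 : C ^ 2 * η * Λ ≤ C ^ 2 * η * Λ ^ 2 := mul_le_mul_of_nonneg_left h1 h0.le
    linarith [mul_pos h0 (by linarith : 0 < Λ)]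
  have h2 : Real.exp (-(1 / (800 * C ^ 2 * η))) ≤ (q * η₀ / (m * n)) ^ 2 := by
    calc Real.exp (-(1 / (800 * C ^ 2 * η))) ≤ Real.exp (-(2 * Λ)) :=
          Real.exp_le_exp.2 (neg_le_neg h1)
      _ = (Real.exp Λ)⁻¹ ^ 2 := by
          rw [← Real.exp_neg, ← Real.exp_nat_mul]; congr 1; push_cast; ring
      _ = _ := by rw [hΛ, Real.exp_log hargpos, inv_div]
  have h3 : (q * η₀ / (m * n)) ^ 2 ≤ q * η₀ / m ^ 2 := by
    rw [div_pow, mul_pow m]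
    have h4 : m ^ 2 ≤ m ^ 2 * n ^ 2 := le_mul_of_one_le_right (by positivity)
      (one_le_pow₀ hn)
    have h5 : (q * η₀) ^ 2 ≤ q * η₀ := by nlinarith
    exact div_le_div₀ hqη₀0.le h5 (by positivity) h4
  have h6 : 64 * (k * C) ≤ m ^ 2 := by
    have h7 : k * C ≤ C ^ 2 * k := by
      rw [mul_comm k]
      exact mul_le_mul_of_nonneg_right (le_self_pow₀ hC two_ne_zero) (by linarith)
    have h8 : m ≤ m ^ 2 := le_self_pow₀ hm two_ne_zero
    linarith [mul_pos (by linarith : 0 < k) (by linarith : 0 < C)]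
  calc 2 * Real.exp (-(1 / (800 * C ^ 2 * η))) ≤ 2 * (q * η₀ / m ^ 2) := by linarith
    _ ≤ 2 * (q * η₀ / (64 * (k * C))) := by gcongr
    _ = _ := by field_simp; norm_num

/-- The lower bound on the number of samples, in terms of the expected numbers of bad samples and
of samples containing a given column. -/
lemma sample_size_bounds {C n m k N γ₀ η η₀ q κ₀ l : ℝ} (hC : 1 ≤ C) (hm : 1 ≤ m) (hn : 1 ≤ n)
    (hk : 1 ≤ k) (hγ₀ : 0 < γ₀) (hγ₀1 : γ₀ ≤ 1) (hη : 0 < η) (hη₀ : 0 < η₀) (hη₀1 : η₀ ≤ 1)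
    (hq : 0 < q) (hl : 0 < l) (hκ₀ : κ₀ = 1 / 64 * γ₀ * η * q / (k * m))
    (hN : 10000 * C ^ 2 * k * n * m * l / (η₀ ^ 3 * γ₀ * κ₀) ≤ N) :
    10000 * l ≤ κ₀ * N ∧ 10000 * C ^ 2 * k ^ 2 * n * l ≤ q * N * (η₀ ^ 3 * η) := by
  have hm0 : 0 < m := by linarith
  have hn0 : 0 < n := by linarith
  have hk0 : 0 < k := by linarith
  have hκpos : 0 < κ₀ := by rw [hκ₀]; positivity
  have hNpos : 0 < N := lt_of_lt_of_le (by positivity) hN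
  have hC2 : 1 ≤ C ^ 2 := one_le_pow₀ hC
  rw [div_le_iff₀ (by positivity)] at hN
  have hκN : 10000 * C ^ 2 * k * n * m * l ≤ κ₀ * N * (η₀ ^ 3 * γ₀) := by linarith
  have hκN0 : 0 < κ₀ * N := by positivity
  constructor
  · have h1 : η₀ ^ 3 * γ₀ ≤ 1 := mul_le_one₀ (pow_le_one₀ hη₀.le hη₀1) hγ₀.le hγ₀1
    have h2 : 1 ≤ C ^ 2 * k * n * m := one_le_mul_of_one_le_of_one_le
      (one_le_mul_of_one_le_of_one_le (one_le_mul_of_one_le_of_one_le hC2 hk) hn) hm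
    calc 10000 * l ≤ 10000 * l * (C ^ 2 * k * n * m) :=
          le_mul_of_one_le_right (by positivity) h2
      _ = 10000 * C ^ 2 * k * n * m * l := by ring
      _ ≤ _ := hκN
      _ ≤ κ₀ * N := mul_le_of_le_one_right hκN0.le h1
  · have h1 : κ₀ * N * (64 * (k * m)) = γ₀ * η * (q * N) := by
      rw [hκ₀]; field_simp
    have h5 : 1 ≤ m * (64 * m) := one_le_mul_of_one_le_of_one_le hm (by linarith)
    have hX : 0 < q * N * (η₀ ^ 3 * η) := by positivity
    calc 10000 * C ^ 2 * k ^ 2 * n * l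
        ≤ 10000 * C ^ 2 * k ^ 2 * n * l * (m * (64 * m)) :=
          le_mul_of_one_le_right (by positivity) h5
      _ = 10000 * C ^ 2 * k * n * m * l * (64 * (k * m)) := by ring
      _ ≤ κ₀ * N * (η₀ ^ 3 * γ₀) * (64 * (k * m)) := by gcongr
      _ = κ₀ * N * (64 * (k * m)) * (η₀ ^ 3 * γ₀) := by ring
      _ = q * N * (η₀ ^ 3 * η) * (γ₀ * γ₀) := by rw [h1]; ring
      _ ≤ _ := mul_le_of_le_one_right hX.le (mul_le_one₀ hγ₀1 hγ₀.le hγ₀1)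

/-- Each of the exceptional events near a column has probability at most `γ / 8`. -/
lemma near_exceptional_bounds {C n k N γ η η₀ q : ℝ} (hC : 1 ≤ C) (hn : 1 ≤ n) (hk : 1 ≤ k)
    (hN : 0 < N) (hγ : 0 < γ) (hγ2 : γ ≤ 1 / 2) (hη : 0 < η) (hη1 : η ≤ 1) (hη₀ : 0 < η₀)
    (hη₀1 : η₀ ≤ 1) (hq : 0 < q) (hl : 1 / 2 ≤ Real.log (1 / γ)) (hnη : n ≤ Real.exp (1 / η))
    (hqN : 10000 * C ^ 2 * k ^ 2 * n * Real.log (1 / γ) ≤ q * N * (η₀ ^ 3 * η)) :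
    Real.exp (-(q * N / 16)) ≤ γ / 8 ∧
      n * (2 * Real.exp (-(η₀ ^ 2 * (q * N) / (512 * n * (k * C) ^ 2)))) ≤ γ / 8 ∧
      Real.exp (-(η₀ * (q * N) / (128 * (k * C)))) ≤ γ / 8 := by
  set l := Real.log (1 / γ) with hldef
  have hl0 : 0 < l := by linarith
  have hC0 : 0 < C := by linarith
  have hk0 : 0 < k := by linarith
  have hn0 : 0 < n := by linarith
  have hqN0 : 0 < q * N := mul_pos hq hN
  have hη₀2 : η₀ ^ 2 * η ≤ 1 := mul_le_one₀ (pow_le_one₀ hη₀.le hη₀1) hη.le hη1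
  have hη₀qN : 10000 * C ^ 2 * k ^ 2 * l ≤ η₀ * (q * N) :=
    calc 10000 * C ^ 2 * k ^ 2 * l ≤ 10000 * C ^ 2 * k ^ 2 * l * n :=
          le_mul_of_one_le_right (by positivity) hn
      _ = 10000 * C ^ 2 * k ^ 2 * n * l := by ring
      _ ≤ _ := hqN
      _ = η₀ * (q * N) * (η₀ ^ 2 * η) := by ring
      _ ≤ η₀ * (q * N) := mul_le_of_le_one_right (by positivity) hη₀2
  refine ⟨exp_neg_le_of_log hγ hγ2 ?_, ?_, exp_neg_le_of_log hγ hγ2 ?_⟩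
  · have h1 : η₀ * (q * N) ≤ q * N := mul_le_of_le_one_left hqN0.le hη₀1
    have h2 : l ≤ C ^ 2 * k ^ 2 * l := le_mul_of_one_le_left hl0.le
      (one_le_mul_of_one_le_of_one_le (one_le_pow₀ hC) (one_le_pow₀ hk))
    linarith
  · have h1 : 8 * l / η ≤ η₀ ^ 2 * (q * N) / (512 * n * (k * C) ^ 2) := by
      rw [div_le_div_iff₀ hη (by positivity)]
      have hX : 0 < C ^ 2 * k ^ 2 * n * l := by positivity
      calc 8 * l * (512 * n * (k * C) ^ 2) = 4096 * (C ^ 2 * k ^ 2 * n * l) := by ring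
        _ ≤ 10000 * C ^ 2 * k ^ 2 * n * l := by linarith
        _ ≤ _ := hqN
        _ = η₀ ^ 2 * (q * N) * η * η₀ := by ring
        _ ≤ _ := mul_le_of_le_one_right (by positivity) hη₀1
    have hη2 : 1 ≤ 1 / η := by rwa [le_div_iff₀ hη, one_mul]
    have h3 : 2 * n ≤ Real.exp (4 * l / η) :=
      calc 2 * n ≤ Real.exp 1 * Real.exp (1 / η) := by
            have h4 : 2 ≤ Real.exp 1 := by linarith [Real.exp_one_gt_d9]
            gcongr
        _ = Real.exp (1 + 1 / η) := (Real.exp_add _ _).symm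
        _ ≤ _ := Real.exp_le_exp.2 (by
            rw [show 4 * l / η = 1 / η * (4 * l) by ring]
            nlinarith)
    calc n * (2 * Real.exp (-(η₀ ^ 2 * (q * N) / (512 * n * (k * C) ^ 2))))
        = 2 * n * Real.exp (-(η₀ ^ 2 * (q * N) / (512 * n * (k * C) ^ 2))) := by ring
      _ ≤ Real.exp (4 * l / η) * Real.exp (-(8 * l / η)) := by
          gcongr
      _ = Real.exp (-(4 * l / η)) := by rw [← Real.exp_add]; congr 1; ring
      _ ≤ γ / 8 := exp_neg_le_of_log hγ hγ2 (by rw [le_div_iff₀ hη]; nlinarith)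
  · rw [le_div_iff₀ (by positivity)]
    have h1 : k * C ≤ C ^ 2 * k ^ 2 := by
      calc k * C ≤ k ^ 2 * C ^ 2 := by
            gcongr
            · exact le_self_pow₀ hk two_ne_zero
            · exact le_self_pow₀ hC two_ne_zero
        _ = _ := mul_comm _ _
    have h2 : k * C * l ≤ C ^ 2 * k ^ 2 * l := by gcongr
    have h3 : 0 < k * C * l := by positivity
    linarith

/-- The bounds that the hypotheses on the parameters are used for. -/
lemma parameter_bounds {C : ℝ} (hC : 1 ≤ C) {n m k N : ℕ} {γ γ₀ η η₀ q κ₀ δ : ℝ}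
    (hk : 2 ≤ k) (hγ : 0 < γ) (hγ2 : γ ≤ 1 / 2) (hγ₀ : 0 < γ₀) (hγ₀1 : γ₀ < 1) (hq : 0 < q)
    (hη₀ : 0 < η₀) (hη₀η : η₀ < η) (hη1 : η < 1)
    (hηm : √(1000 * C ^ 2 * k / m) < η)
    (hηlog : η < 1 / (10000 * C ^ 2) / Real.log (m * n / (q * η₀)) ^ 2)
    (hκ₀ : κ₀ = 1 / 64 * γ₀ * η * q / (k * m))
    (hN : 10000 * C ^ 2 * k * n * m * Real.log (1 / γ) / (η₀ ^ 3 * γ₀ * κ₀) ≤ N)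
    (hq1 : 0 < m → 0 < N → q ≤ 1) (hδ : δ < (η / (16 * C * Real.log (1 / κ₀))) ^ 2) :
    0 < n ∧ 0 < m ∧ 0 < N ∧ 0 < κ₀ ∧ q ≤ 1 ∧ 10000 * C ^ 2 * η ≤ 1 ∧ 4 ≤ Real.log (1 / κ₀) ∧
      4096 * C ^ 2 * δ ≤ η ^ 2 ∧
      2 * Real.exp (-(1 / (800 * C ^ 2 * η))) ≤ η₀ * q / (32 * (k * C)) ∧
      Real.exp (-(2 * κ₀ * N) / 8) ≤ γ / 8 ∧ Real.exp (-(q * N / 16)) ≤ γ / 8 ∧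
      n * (2 * Real.exp (-(η₀ ^ 2 * (q * N) / (512 * n * (k * C) ^ 2)))) ≤ γ / 8 ∧
      Real.exp (-(η₀ * (q * N) / (128 * (k * C)))) ≤ γ / 8 := by
  have hη : 0 < η := hη₀.trans hη₀η
  have hC0 : 0 < C := by linarith
  have hC2 : 1 ≤ C ^ 2 := one_le_pow₀ hC
  have hk2 : (2 : ℝ) ≤ k := by exact_mod_cast hk
  -- `m` and `n` are positive, as the logarithm would otherwise be `log 0 = 0`
  have hmn : 0 < m ∧ 0 < n := by
    by_contra hcon
    have h0 : (m : ℝ) * n = 0 := by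
      rcases Nat.eq_zero_or_pos m with h | h
      · simp [h]
      · rcases Nat.eq_zero_or_pos n with h' | h'
        · simp [h']
        · exact absurd ⟨h, h'⟩ hcon
    rw [h0, zero_div, Real.log_zero, zero_pow two_ne_zero, div_zero] at hηlog
    linarith
  obtain ⟨hm, hn⟩ := hmn
  have hm1 : (1 : ℝ) ≤ m := by exact_mod_cast hm
  have hn1 : (1 : ℝ) ≤ n := by exact_mod_cast hn
  have hm0 : (0 : ℝ) < m := by linarith
  have hn0 : (0 : ℝ) < n := by linarith
  have hk0 : (0 : ℝ) < k := by linarith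
  have hκpos : 0 < κ₀ := by rw [hκ₀]; positivity
  have hl : 1 / 2 ≤ Real.log (1 / γ) := by
    have h1 : Real.log 2 ≤ Real.log (1 / γ) := Real.log_le_log (by norm_num) (by
      rw [le_div_iff₀ hγ]; linarith)
    linarith [Real.log_two_gt_d9]
  have hl0 : 0 < Real.log (1 / γ) := by linarith
  have hNpos : (0 : ℝ) < N := lt_of_lt_of_le (by positivity) hN
  have hN0 : 0 < N := by exact_mod_cast hNpos
  have hq1 := hq1 hm hN0
  have hη₀1 : η₀ < 1 := hη₀η.trans hη1
  have hmk : 1000 * C ^ 2 * k ≤ m := by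
    by_contra hcon
    have h1 : 1 ≤ 1000 * C ^ 2 * k / m := by
      rw [le_div_iff₀ hm0]
      linarith
    linarith [Real.one_le_sqrt.2 h1]
  have hqη₀ : q * η₀ ≤ 1 := mul_le_one₀ hq1 hη₀.le hη₀1.le
  have hqη₀0 : 0 < q * η₀ := mul_pos hq hη₀
  have hmle : (m : ℝ) ≤ m * n / (q * η₀) := by
    rw [le_div_iff₀ hqη₀0]
    exact mul_le_mul_of_nonneg_left (hqη₀.trans hn1) hm0.le
  have hnle : (n : ℝ) ≤ m * n / (q * η₀) := by
    rw [le_div_iff₀ hqη₀0, mul_comm (m : ℝ)]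
    exact mul_le_mul_of_nonneg_left (hqη₀.trans hm1) hn0.le
  have hargpos : 0 < (m : ℝ) * n / (q * η₀) := by positivity
  have hΛ1 : 1 ≤ Real.log (m * n / (q * η₀)) := by
    rw [Real.le_log_iff_exp_le hargpos]
    have h1 : 1 ≤ C ^ 2 * k := one_le_mul_of_one_le_of_one_le hC2 (by linarith)
    linarith [Real.exp_one_lt_d9]
  have hΛη : 10000 * C ^ 2 * η * Real.log (m * n / (q * η₀)) ^ 2 < 1 := by
    rw [lt_div_iff₀ (by positivity), lt_div_iff₀ (by positivity)] at hηlog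
    linarith
  have hCη : 10000 * C ^ 2 * η ≤ 1 :=
    (le_mul_of_one_le_right (by positivity) (one_le_pow₀ hΛ1)).trans hΛη.le
  have hnη : (n : ℝ) ≤ Real.exp (1 / η) := by
    refine hnle.trans ?_
    rw [← Real.log_le_iff_le_exp hargpos, le_div_iff₀ hη]
    have h1 : Real.log (m * n / (q * η₀)) ≤ Real.log (m * n / (q * η₀)) ^ 2 :=
      le_self_pow₀ hΛ1 two_ne_zero
    have h2 : η * Real.log (m * n / (q * η₀)) ^ 2 ≤
        10000 * C ^ 2 * (η * Real.log (m * n / (q * η₀)) ^ 2) :=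
      le_mul_of_one_le_left (by positivity) (by linarith)
    have h3 := mul_le_mul_of_nonneg_left h1 hη.le
    linarith
  have hκ64 : κ₀ ≤ 1 / 64 := by
    rw [hκ₀, div_le_iff₀ (by positivity)]
    have h1 : γ₀ * η * q ≤ 1 :=
      mul_le_one₀ (mul_le_one₀ hγ₀1.le hη.le hη1.le) hq.le hq1
    have h2 : 1 ≤ (k : ℝ) * m := one_le_mul_of_one_le_of_one_le (by linarith) hm1
    linarith
  have hL : 4 ≤ Real.log (1 / κ₀) := by
    have h1 : Real.log 64 ≤ Real.log (1 / κ₀) := Real.log_le_log (by norm_num) (by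
      rw [le_div_iff₀ hκpos]; linarith)
    have h2 : Real.log 64 = 6 * Real.log 2 := by
      rw [show (64 : ℝ) = 2 ^ 6 by norm_num, Real.log_pow]; norm_num
    linarith [Real.log_two_gt_d9]
  have hδ' : 4096 * C ^ 2 * δ ≤ η ^ 2 := by
    have h1 : (η / (16 * C * Real.log (1 / κ₀))) ^ 2 ≤ (η / (16 * C * 4)) ^ 2 := by gcongr
    have h2 : (η / (16 * C * 4)) ^ 2 = η ^ 2 / (4096 * C ^ 2) := by
      rw [div_pow]; ring
    have h3 := hδ.le.trans (h1.trans_eq h2)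
    rw [le_div_iff₀ (by positivity)] at h3
    linarith
  have hk1 : (1 : ℝ) ≤ k := by linarith
  have hexp := exp_neg_inv_le hC hm1 hn1 hk1 hη hq hq1 hη₀ hη₀1.le hmk hΛ1 hΛη
  obtain ⟨hκN, hqN⟩ := sample_size_bounds hC hm1 hn1 hk1 hγ₀ hγ₀1.le hη hη₀ hη₀1.le hq hl0 hκ₀ hN
  refine ⟨hn, hm, hN0, hκpos, hq1, hCη, hL, hδ', hexp, ?_,
    near_exceptional_bounds hC hn1 hk1 hNpos hγ hγ2 hη hη1.le hη₀ hη₀1.le hq hl hnη hqN⟩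
  rw [neg_div]
  exact exp_neg_le_of_log hγ hγ2 (by linarith)

end Parameters

/-! ### Failure probabilities and the main result -/

section Assembly

variable {n N m k : ℕ} {A : Matrix (Fin n) (Fin m) ℝ} {C : ℝ}
  {Ω : Type*} [MeasurableSpace Ω] {P : Measure Ω} [IsProbabilityMeasure P]
  {D : Measure ℝ} {S : Fin N → Finset (Fin m)} {x : Fin N → Fin m → Ω → ℝ} {δ : ℝ}

open Classical in
/-- If `z` is very close to `b A i`, TestColumn answers YES except with small probability. -/
lemma measureReal_testColumn_none (h : IsCoeffSample P D S x) (hD : IsSpikeSlab C D) (hC : 1 ≤ C)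
    (hS : ∀ r, (S r).card ≤ k) (hR : IsRIP k δ A) (hk : 2 ≤ k) (hδ0 : 0 ≤ δ)
    (hA : ∀ i, ‖column A i‖ = 1) {η q κ κ₁ L : ℝ} (hη : 0 < η) (hη1 : η ≤ 1) (hL : 4 ≤ L)
    (hδ : δ ≤ (η / (16 * C * L)) ^ 2) (hκ : 2 * Real.exp (-L ^ 2) ≤ κ / 2)
    {z : Vec n} (hz : ‖z‖ = 1) {i : Fin m} {b : ℝ}
    (hb : b = -1 ∨ b = 1) (hzi : ‖z - b • column A i‖ ≤ η / (8 * C * L)) (hN : 0 < N)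
    (hM : q * N ≤ ((Finset.univ.filter (fun r => i ∈ S r)).card : ℝ)) (hκq : κ₁ + κ ≤ q) :
    P.real {ω | ¬ ∃ zhat, testColumn C z (fun r => apply A (fun i => x r i ω)) κ κ₁ η =
      some zhat} ≤ Real.exp (-(κ * N) / 8) := by
  have hC0 : 0 < C := by linarith
  have hL0 : 0 < L := by linarith
  have hCL : 4 ≤ C * L := by nlinarith
  have hρ : ‖z - b • column A i‖ ^ 2 ≤ η ^ 2 / (64 * (C * L) ^ 2) := by
    refine (pow_le_pow_left₀ (norm_nonneg _) hzi 2).trans (le_of_eq ?_)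
    rw [div_pow]; ring
  have hδ2 : δ ≤ η ^ 2 / (256 * (C * L) ^ 2) := by
    refine hδ.trans (le_of_eq ?_)
    rw [div_pow]; ring
  have hδ1 : δ ≤ 1 / 9 := by
    refine hδ2.trans ?_
    rw [div_le_iff₀ (by positivity)]
    nlinarith
  have hsmall : η ^ 2 / (64 * (C * L) ^ 2) ≤ η := by
    rw [div_le_iff₀ (by positivity), sq η]
    exact mul_le_mul_of_nonneg_left (by nlinarith) hη.le
  have hbi : 1 - η / 2 ≤ b * ⟪z, column A i⟫_ℝ := by
    have h1 := hρ.trans hsmall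
    rw [norm_sub_smul_column_sq hA hz i hb] at h1
    linarith
  have hbabs : |⟪z, column A i⟫_ℝ| = |b * ⟪z, column A i⟫_ℝ| := by
    rw [abs_mul]
    rcases hb with rfl | rfl <;> simp
  have hi1 : |⟪z, column A i⟫_ℝ| ≤ 1 := by
    have := abs_real_inner_le_norm z (column A i)
    rwa [hz, hA, mul_one] at this
  have hcount := cross_count_le h hD hC0 hS hR hk hδ0 hδ1 hA hb hρ (t := η / 2)
    (σ := η ^ 2 / (8 * (C * L) ^ 2)) (T := κ * N) (by positivity) (by
      have e1 : 3 * (η ^ 2 / (64 * (C * L) ^ 2)) + 6 * (η ^ 2 / (256 * (C * L) ^ 2)) =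
        9 / 16 * (η ^ 2 / (8 * (C * L) ^ 2)) := by field_simp; norm_num
      have e2 : 0 < η ^ 2 / (8 * (C * L) ^ 2) := by positivity
      linarith) (by
      have e1 : (η / 2) ^ 2 / (2 * (C ^ 2 * (η ^ 2 / (8 * (C * L) ^ 2)))) = L ^ 2 := by
        field_simp; norm_num
      rw [e1]
      calc (N : ℝ) * (2 * Real.exp (-L ^ 2)) ≤ N * (κ / 2) := by gcongr
        _ = κ * N / 2 := by ring)
  refine le_trans (ENNReal.toReal_mono (measure_ne_top _ _) (measure_mono_ae ?_)) hcount
  filter_upwards [h.ae_mem hD] with ω hω hno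
  by_contra hcon
  exact hno (testColumn_isSome_of_cross_count hC
    (by rw [hbabs]; exact hbi.trans (le_abs_self _)) hi1 hη hη1 hN
    (fun r j hj => h.zero r j hj ω) hω hM hκq (not_le.1 hcon))

/-- The soundness alternative: either `z` is close to some `b A i`, or it is far from all. -/
lemma near_or_far (hA : ∀ i, ‖column A i‖ = 1) {z : Vec n} (hz : ‖z‖ = 1) (η : ℝ) :
    (∃ i, ∃ b : ℝ, (b = -1 ∨ b = 1) ∧ ‖z - b • column A i‖ ≤ √(8 * η) ∧
      ‖z - b • column A i‖ ^ 2 ≤ 8 * η) ∨ ∀ i, |⟪z, column A i⟫_ℝ| < 1 - 4 * η := by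
  by_contra hcon
  push Not at hcon
  obtain ⟨hfar, i, hi⟩ := hcon
  rcases abs_cases ⟪z, column A i⟫_ℝ with h | h
  · have h1 : ‖z - (1 : ℝ) • column A i‖ ^ 2 ≤ 8 * η := by
      rw [norm_sub_smul_column_sq hA hz i (Or.inr rfl)]
      linarith
    exact absurd h1 (not_le.2 (hfar i 1 (Or.inr rfl) (Real.le_sqrt_of_sq_le h1)))
  · have h1 : ‖z - (-1 : ℝ) • column A i‖ ^ 2 ≤ 8 * η := by
      rw [norm_sub_smul_column_sq hA hz i (Or.inl rfl)]
      linarith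
    exact absurd h1 (not_le.2 (hfar i (-1) (Or.inl rfl) (Real.le_sqrt_of_sq_le h1)))

end Assembly

end DictTest

theorem theorem3p1 (C : ℝ) (hC : 1 ≤ C) :
    ∃ c₀ c₁ c₂ c₃ c₄ c₅ : ℝ,
      0 < c₀ ∧ 0 < c₁ ∧ 0 < c₂ ∧ 0 < c₃ ∧ 0 < c₄ ∧ 0 < c₅ ∧
      ∀ (n m k N : ℕ) (γ γ₀ η η₀ q κ₀ δ : ℝ),
        2 ≤ k → 0 < γ → γ ≤ 1 / 2 → 0 < γ₀ → γ₀ < 1 → 0 < q →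
        0 < η₀ → η₀ < η → η < 1 →
        √(c₃ * k / m) < η → η < c₁ / (Real.log (m * n / (q * η₀))) ^ 2 →
        κ₀ = c₄ * γ₀ * η * q / (k * m) →
        c₂ * k * n * m * Real.log (1 / γ) / (η₀ ^ 3 * γ₀ * κ₀) ≤ N →
      ∀ D : Measure ℝ, DictTest.IsSpikeSlab C D → γ₀ ≤ D.real (Set.Icc 1 (1 + η)) →
      ∀ A : Matrix (Fin n) (Fin m) ℝ, (∀ i, ‖DictTest.column A i‖ = 1) →
        DictTest.IsRIP k δ A → δ < (η / (16 * C * Real.log (1 / κ₀))) ^ 2 →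
      ∀ S : Fin N → Finset (Fin m), (∀ r, (S r).card ≤ k) →
        (∀ (i : Fin m) (T : Finset (Fin m)), i ∉ T → (T.card : ℝ) ≤ c₃ / η ^ 2 →
          q * N ≤ ({r | i ∈ S r ∧ Disjoint (S r) T}.ncard : ℝ)) →
      ∀ z : DictTest.Vec n, ‖z‖ = 1 →
        -- running time
        (∀ (w : ℕ), 1 ≤ w → ∀ y : Fin N → DictTest.Vec n,
          (DictTest.testColumnProgram w C z y (2 * κ₀) (c₅ * q * γ₀ * η) η).value =
              DictTest.testColumn C z y (2 * κ₀) (c₅ * q * γ₀ * η) η ∧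
          ((DictTest.testColumnProgram w C z y (2 * κ₀) (c₅ * q * γ₀ * η) η).steps : ℝ) ≤
              c₀ * w * N) ∧
        -- completeness and soundness
        ∀ (Ω : Type*) [MeasurableSpace Ω] (P : Measure Ω) [IsProbabilityMeasure P]
          (x : Fin N → Fin m → Ω → ℝ), DictTest.IsCoeffSample P D S x →
          1 - γ ≤ P.real {ω |
            ((∃ i : Fin m, ∃ b ∈ ({-1, 1} : Set ℝ),
                ‖z - b • DictTest.column A i‖ ≤ η / (8 * C * Real.log (1 / κ₀))) →
              ∃ zhat, DictTest.testColumn C z (fun r => DictTest.apply A (fun i => x r i ω))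
                (2 * κ₀) (c₅ * q * γ₀ * η) η = some zhat) ∧
            (∀ zhat, DictTest.testColumn C z (fun r => DictTest.apply A (fun i => x r i ω))
                (2 * κ₀) (c₅ * q * γ₀ * η) η = some zhat →
              ∃ i : Fin m, ∃ b ∈ ({-1, 1} : Set ℝ),
                ‖z - b • DictTest.column A i‖ ≤ √(8 * η) ∧
                ‖zhat - b • DictTest.column A i‖ ≤ η₀)} := by
  classical
  have hC0 : 0 < C := by linarith
  -- `21 w N` bounds the step count `N (2 w + 8) + 3 w + 8`; `1000 C²` exceeds the `8 C²` from
  -- counting large correlations; the YES threshold `1 / 2` exceeds `8 / 64`, so that it is at least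
  -- twice the high fraction possible far from all columns
  refine ⟨21, 1 / (10000 * C ^ 2), 10000 * C ^ 2, 1000 * C ^ 2, 1 / 64, 1 / 2, by norm_num,
    by positivity, by positivity, by positivity, by norm_num, by norm_num, ?_⟩
  intro n m k N γ γ₀ η η₀ q κ₀ δ hk hγ hγ2 hγ₀ hγ₀1 hq hη₀ hη₀η hη1 hηm hηlog hκ₀ hN D hD hDγ
    A hA hR hδ S hS hST z hz
  have hη : 0 < η := hη₀.trans hη₀η
  have hM : ∀ i, q * N ≤ ((Finset.univ.filter (fun r => i ∈ S r)).card : ℝ) := by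
    intro i
    have h1 := hST i ∅ (Finset.notMem_empty i) (by
      rw [Finset.card_empty, Nat.cast_zero]; positivity)
    have h2 : {r | i ∈ S r ∧ Disjoint (S r) ∅}.ncard =
        (Finset.univ.filter (fun r => i ∈ S r)).card := by
      rw [← Set.ncard_coe_finset]
      congr 1
      ext r
      simp
    rwa [h2] at h1
  obtain ⟨hn, hm, hN0, hκpos, hq1, hCη, hL, hδ4096, hexp, hexp1, hexp2, hexp3, hexp4⟩ :=
    DictTest.parameter_bounds hC hk hγ hγ2 hγ₀ hγ₀1 hq hη₀ hη₀η hη1 hηm hηlog hκ₀ hN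
      (fun hm hN0 => by
        have h1 := (hM ⟨0, hm⟩).trans (Nat.cast_le.2 (Finset.card_le_univ _))
        rw [Fintype.card_fin] at h1
        have hN' : (0 : ℝ) < N := by exact_mod_cast hN0
        exact le_of_mul_le_mul_right (by rwa [one_mul]) hN') hδ
  have hm1 : (1 : ℝ) ≤ m := by exact_mod_cast hm
  have hN1 : (1 : ℝ) ≤ N := by exact_mod_cast hN0
  have hk2 : (2 : ℝ) ≤ k := by exact_mod_cast hk
  have hC2 : 1 ≤ C ^ 2 := one_le_pow₀ hC
  have hδ0 : 0 ≤ δ := hR.nonneg (by omega) hA ⟨0, hm⟩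
  have hCη0 : 0 < C ^ 2 * η := by positivity
  have hηC : η ≤ C ^ 2 * η := le_mul_of_one_le_left hη.le hC2
  have hδC : δ ≤ C ^ 2 * δ := le_mul_of_one_le_left hδ0 hC2
  have hη2 : η ^ 2 ≤ η := pow_le_of_le_one hη.le hη1.le two_ne_zero
  have hδ6 : 6 * δ ≤ η := by linarith
  have hδ24 : 24 * C ^ 2 * δ ≤ η ^ 2 := by linarith
  have hη6 : 6 * C ^ 2 * η < 1 := by linarith
  -- `κ₀` is small compared with the YES threshold, even after the loss of a factor `m + 1`
  have hκm : (m + 1) * κ₀ ≤ 1 / 64 * (q * γ₀ * η) := by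
    have h1 : κ₀ * (k * m) = 1 / 64 * (q * γ₀ * η) := by
      rw [hκ₀]; field_simp
    rw [← h1, mul_comm]
    have h2 : (m : ℝ) + 1 ≤ k * m := by nlinarith
    gcongr
  have hκ1 : κ₀ ≤ (m + 1) * κ₀ := le_mul_of_one_le_left hκpos.le (by linarith)
  have hqγη : q * γ₀ * η ≤ q * γ₀ := mul_le_of_le_one_right (by positivity) hη1.le
  have hqγ : q * γ₀ ≤ q := mul_le_of_le_one_right hq.le hγ₀1.le
  have hqγ0 : 0 < q * γ₀ := by positivity
  constructor
  · intro w hw y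
    refine ⟨DictTest.testColumnProgram_value .., ?_⟩
    have h1 := DictTest.testColumnProgram_steps (w := w) C z y (2 * κ₀) (1 / 2 * q * γ₀ * η) η
    have hw1 : (1 : ℝ) ≤ w := by exact_mod_cast hw
    have h2 : ((DictTest.testColumnProgram w C z y (2 * κ₀) (1 / 2 * q * γ₀ * η) η).steps : ℝ) ≤
        N * (2 * w + 8) + 3 * w + 8 := by exact_mod_cast h1
    nlinarith only [h2, hw1, hN1, mul_nonneg (sub_nonneg.2 hw1) (sub_nonneg.2 hN1)]
  intro Ω _ P _ x hx
  -- the two failure events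
  set bad₁ := {ω | (∃ i : Fin m, ∃ b ∈ ({-1, 1} : Set ℝ),
      ‖z - b • DictTest.column A i‖ ≤ η / (8 * C * Real.log (1 / κ₀))) ∧
    ¬ ∃ zhat, DictTest.testColumn C z (fun r => DictTest.apply A (fun i => x r i ω))
      (2 * κ₀) (1 / 2 * q * γ₀ * η) η = some zhat} with hbad₁
  set bad₂ := {ω | ∃ zhat, DictTest.testColumn C z (fun r => DictTest.apply A (fun i => x r i ω))
      (2 * κ₀) (1 / 2 * q * γ₀ * η) η = some zhat ∧
      ¬ ∃ i : Fin m, ∃ b ∈ ({-1, 1} : Set ℝ), ‖z - b • DictTest.column A i‖ ≤ √(8 * η) ∧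
        ‖zhat - b • DictTest.column A i‖ ≤ η₀} with hbad₂
  have h1 : P.real bad₁ ≤ γ / 8 := by
    by_cases hnear : ∃ i : Fin m, ∃ b ∈ ({-1, 1} : Set ℝ),
      ‖z - b • DictTest.column A i‖ ≤ η / (8 * C * Real.log (1 / κ₀))
    · obtain ⟨i, b, hb, hzi⟩ := hnear
      refine le_trans (measureReal_mono (fun ω hω => hω.2) (measure_ne_top _ _))
        ((DictTest.measureReal_testColumn_none hx hD hC hS hR hk hδ0 hA hη hη1.le hL hδ.le ?_ hz
          hb hzi hN0 (hM i) (by linarith)).trans hexp1)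
      have h2 : Real.exp (-Real.log (1 / κ₀)) = κ₀ := by
        rw [one_div, Real.log_inv, neg_neg, Real.exp_log hκpos]
      have h3 : Real.exp (-Real.log (1 / κ₀) ^ 2) ≤ κ₀ * Real.exp (-1) := by
        conv_rhs => rw [← h2, ← Real.exp_add]
        exact Real.exp_le_exp.2 (by nlinarith only [hL])
      have h4 : Real.exp (-1) ≤ 1 / 2 := by
        rw [Real.exp_neg, one_div]
        exact inv_anti₀ (by norm_num) (by linarith [Real.exp_one_gt_d9])
      linarith [mul_le_mul_of_nonneg_left h4 hκpos.le]
    · have : bad₁ = ∅ := Set.eq_empty_of_forall_notMem fun ω hω => hnear hω.1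
      rw [this, measureReal_empty]
      positivity
  have h2 : P.real bad₂ ≤ 3 * (γ / 8) := by
    rcases DictTest.near_or_far hA hz η with ⟨i, b, hb, hzi, hzi2⟩ | hfar
    · refine le_trans (measureReal_mono (fun ω hω => ?_) (measure_ne_top _ _))
        ((DictTest.measureReal_mean_near hx hD hC hS hR hk hδ0 hA hη (by linarith)
          hδ6 hη₀ (hη₀η.trans hη1) hn hz hb hzi2 hq hN0 (hM i) hexp).trans
          (by linarith))
      obtain ⟨zhat, hzhat, hno⟩ := hω
      intro hclose
      refine hno ⟨i, b, hb, hzi, ?_⟩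
      rw [DictTest.testColumn] at hzhat
      split_ifs at hzhat
      rw [← Option.some.inj hzhat]
      exact hclose
    · refine le_trans (measureReal_mono (fun ω hω => ?_) (measure_ne_top _ _))
        ((DictTest.measureReal_testColumn_far (κ₀ := 2 * κ₀) (κ₁ := 1 / 2 * q * γ₀ * η)
          hx hD hC hDγ hR hk hδ0 hδ24 hA hη hη6
          (fun i T hT hTc => hST i T hT (hTc.trans (by gcongr; norm_num))) hz hfar hγ₀ hN0
          (by linarith) (by linarith) (by linarith)).trans (hexp1.trans (by linarith)))
      obtain ⟨zhat, hzhat, -⟩ := hω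
      exact ⟨zhat, hzhat⟩
  -- everything outside the two failure events is good
  refine le_trans ?_ (measureReal_mono (s₁ := (bad₁ ∪ bad₂)ᶜ) (fun ω hω => ?_)
    (measure_ne_top _ _))
  · have h3 := measureReal_union_le (μ := P) (bad₁ ∪ bad₂) (bad₁ ∪ bad₂)ᶜ
    rw [Set.union_compl_self, probReal_univ] at h3
    have h4 := measureReal_union_le (μ := P) bad₁ bad₂
    linarith
  · constructor
    · intro hnear
      by_contra hno
      exact hω (Or.inl ⟨hnear, hno⟩)
    · intro zhat hzhat
      by_contra hno
      exact hω (Or.inr ⟨zhat, hzhat, hno⟩)
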